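/- All Banach spaces are real, and $c_{00}$ is the space of finitely supported real sequences. A basic sequence in a Banach space is a sequence $(x_i)$ of non-zero vectors for which there is a constant $C$ with $\|\sum_{i\le n}a_ix_i\|\le C\|\sum_{i=1}^\infty a_ix_i\|$ for all $(a_i)\in c_{00}$ and $n\in\mathbb N$. For $\delta\in(0,1]$, a basic sequence $(x_i)$ is called $\delta$-convex-unconditional with constant $A$ if for all $(a_i)\in c_{00}$ and all finite $E\subset\mathbb N$, $$\delta\sum_{i\in E}|a_i|\le\Big\|\sum_{i\in E}a_ix_i\Big\|\quad\text{implies}\quad\Big\|\sum_{i\in E}a_ix_i\Big\|\le A\,\Big\|\sum_{i=1}^\infty a_ix_i\Big\|.$$ For a normalized, weakly null sequence $(x_i)$, let $A((x_i),\delta)$ be the infimum of the constants $A\in[0,\infty)$ such that $(x_i)$ is $\delta$-convex-unconditional with constant $A$, and let $K'((x_i),\delta)$ be the infimum of the constants $C\in[0,\infty)$ such that $\|\sum_{i\in E}a_ix_i\|\le C\|\sum_{i=1}^\infty a_ix_i\|$ whenever $(a_i)\in c_{00}$, $E\subset\{i\in\mathbb N: |a_i|\ge\delta\}$ and $\|\sum_{i=1}^\infty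 a_ix_i\|\le 1$ (here $\inf\emptyset=\infty$). Put $$A(\delta)=\sup_{(x_i)}\inf_{(y_i)\subset(x_i)}A((y_i),\delta),\qquad K'(\delta)=\sup_{(x_i)}\inf_{(y_i)\subset(x_i)}K'((y_i),\delta),$$ where the suprema are over all normalized, weakly null sequences $(x_i)$ in Banach spaces and the infima are over all subsequences $(y_i)$ of $(x_i)$. **Theorem.** For $0<\delta_1<\delta\le 1$ we have, in $[0,\infty]$, (i) $A(\delta)\le\dfrac{\delta}{\delta-\delta_1}\,K'(\delta_1)$, and (ii) $K'(\delta)\le A(\delta_1)$. In particular, $\sup_{0<\delta\le1}A(\delta)=\sup_{0<\delta\le1}K'(\delta)$. -/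

import Mathlib

open Filter
open scoped NNReal ENNReal Topology

universe u

namespace PartialUncond

/-- A normalized, weakly null sequence in a real normed space. -/
def NormalizedWeaklyNull {X : Type u} [NormedAddCommGroup X] [NormedSpace ℝ X]
    (x : ℕ → X) : Prop :=
  (∀ n, ‖x n‖ = 1) ∧ ∀ f : X →L[ℝ] ℝ, Tendsto (fun n => f (x n)) atTop (𝓝 0)

/-- A basic sequence: the vectors are non-zero, and the projections onto initial segments of the
coordinates are uniformly bounded on the finite linear combinations. -/
def IsBasicSequence {X : Type u} [NormedAddCommGroup X] [NormedSpace ℝ X]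
    (x : ℕ → X) : Prop :=
  (∀ n, x n ≠ 0) ∧ ∃ C : ℝ, ∀ (a : ℕ →₀ ℝ) (n : ℕ),
    ‖∑ i ∈ Finset.range n, a i • x i‖ ≤ C * ‖a.sum fun i c => c • x i‖

/-- The basic sequence `x` is `δ`-convex-unconditional with constant `A`. The finitely supported
functions `a : ℕ →₀ ℝ` are the elements of `c₀₀`. -/
def IsConvexUnconditional {X : Type u} [NormedAddCommGroup X] [NormedSpace ℝ X]
    (δ A : ℝ) (x : ℕ → X) : Prop :=
  IsBasicSequence x ∧ ∀ (a : ℕ →₀ ℝ) (E : Finset ℕ),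
    δ * ∑ i ∈ E, |a i| ≤ ‖∑ i ∈ E, a i • x i‖ →
      ‖∑ i ∈ E, a i • x i‖ ≤ A * ‖a.sum fun i c => c • x i‖

/-- `A((xᵢ), δ)`: the infimum of the constants `A` for which `x` is `δ`-convex-unconditional with
constant `A`; it is `∞` if there are none. -/
noncomputable def convexConstOf {X : Type u} [NormedAddCommGroup X] [NormedSpace ℝ X]
    (x : ℕ → X) (δ : ℝ) : ℝ≥0∞ :=
  ⨅ (A : ℝ≥0) (_ : IsConvexUnconditional δ A x), (A : ℝ≥0∞)

/-- `K'((xᵢ), δ)`: the infimum of the constants `C` such that `‖∑_{i ∈ E} aᵢ xᵢ‖ ≤ C ‖∑ᵢ aᵢ xᵢ‖`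
whenever `a ∈ c₀₀`, `‖∑ᵢ aᵢ xᵢ‖ ≤ 1` and `|aᵢ| ≥ δ` for all `i ∈ E`; it is `∞` if there are none.
For `δ > 0` such a set `E` is automatically finite. -/
noncomputable def nearConstOf {X : Type u} [NormedAddCommGroup X] [NormedSpace ℝ X]
    (x : ℕ → X) (δ : ℝ) : ℝ≥0∞ :=
  ⨅ (C : ℝ≥0) (_ : ∀ (a : ℕ →₀ ℝ) (E : Finset ℕ), (∀ i ∈ E, δ ≤ |a i|) →
      ‖a.sum fun i c => c • x i‖ ≤ 1 →
      ‖∑ i ∈ E, a i • x i‖ ≤ C * ‖a.sum fun i c => c • x i‖), (C : ℝ≥0∞)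

/-- `A(δ)`: the supremum over all normalized, weakly null sequences `x` in real Banach spaces of
the infimum over all subsequences `x ∘ φ` of `A((x_{φ(i)}), δ)`. -/
noncomputable def convexConst (δ : ℝ) : ℝ≥0∞ :=
  ⨆ (X : Type u) (_ : NormedAddCommGroup X) (_ : NormedSpace ℝ X) (_ : CompleteSpace X)
    (x : ℕ → X) (_ : NormalizedWeaklyNull x),
    ⨅ (φ : ℕ → ℕ) (_ : StrictMono φ), convexConstOf (x ∘ φ) δ

/-- `K'(δ)`: the supremum over all normalized, weakly null sequences `x` in real Banach spaces of
the infimum over all subsequences `x ∘ φ` of `K'((x_{φ(i)}), δ)`. -/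
noncomputable def nearConst (δ : ℝ) : ℝ≥0∞ :=
  ⨆ (X : Type u) (_ : NormedAddCommGroup X) (_ : NormedSpace ℝ X) (_ : CompleteSpace X)
    (x : ℕ → X) (_ : NormalizedWeaklyNull x),
    ⨅ (φ : ℕ → ℕ) (_ : StrictMono φ), nearConstOf (x ∘ φ) δ

end PartialUncond

/-! Both inequalities rest on a duality: if one constant is bad on all subsequences of `x`, there is
another normalized weakly null sequence on which the other constant is bad, with vectors and
functionals exchanging roles.

Suppose that every subsequence of `x` fails with constant Λ. Then each infinite set of indices
contains the support of some `a` with ‖∑ aᵢxᵢ‖ = 1 and ‖∑_{i∈E} aᵢxᵢ‖ > Λ; let `f` norm the latter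
vector. A Ramsey argument (`exists_infinite_forall_subset_sum_le`, `exists_antichain_family`)
selects such pairs (a_s, f_s), indexed by an antichain of finite subsets s of an infinite set N,
with f_s almost zero on the points of N below max s and outside s. As `x` may be taken almost
monotone basic, |∑_{i∈s} f_s(xᵢ) a_t(i)| ≤ (1+η)² for all s and t.

Let yᵢ be the i-th coordinate function on the set of all a_t and all unit vectors, with the supremum
norm. Then ∑_{i∈s} f_s(xᵢ)yᵢ has norm at most (1+η)², while its part over E has norm at least
∑_{i∈E} f_s(xᵢ)a_s(i). The antichain forces pointwise limits of the a_t to be finitely supported, so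
`y` is weakly null (`exists_dual_sequence`).

For (i), the indices of E with |f(xᵢ)| below about δ₁ are dropped; by convexity this loses at most
the fraction δ₁/δ of the norm, and what remains has large coefficients in `y`. For (ii), the indices
of E with f(xᵢ)aᵢ ≥ 0 are kept; there |aᵢ| ≥ δ gives ∑ f(xᵢ)aᵢ ≥ δ ∑ |f(xᵢ)|, which is the convexity
condition in `y`. -/

namespace PartialUncond

/-! ### Infinite combinatorics: fusion and Ramsey sets -/

/-- Fusion: a condition on a finite set of chosen elements and an infinite reservoir, which can
always be extended, can be iterated along a strictly increasing sequence. -/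
theorem exists_fusion {P : Finset ℕ → Set ℕ → Prop} {R₀ : Set ℕ} (hR₀ : R₀.Infinite)
    (h0 : P ∅ R₀)
    (step : ∀ F R, R ⊆ R₀ → R.Infinite → P F R →
      ∃ n ∈ R, ∃ R' ⊆ R, R'.Infinite ∧ (∀ j ∈ R', n < j) ∧ P (insert n F) R') :
    ∃ (n : ℕ → ℕ) (R : ℕ → Set ℕ), StrictMono n ∧ Antitone R ∧ (∀ k, R k ⊆ R₀) ∧
      (∀ k, (R k).Infinite) ∧ (∀ k, n k ∈ R k) ∧ (∀ k, ∀ j ∈ R (k + 1), n k < j) ∧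
      ∀ k, P ((Finset.range k).image n) (R k) := by
  let T := {p : Finset ℕ × Set ℕ // p.2 ⊆ R₀ ∧ p.2.Infinite ∧ P p.1 p.2}
  have step' : ∀ p : T, ∃ q : ℕ × Set ℕ, q.1 ∈ p.1.2 ∧ q.2 ⊆ p.1.2 ∧ q.2.Infinite ∧
      (∀ j ∈ q.2, q.1 < j) ∧ P (insert q.1 p.1.1) q.2 := by
    rintro ⟨⟨F, R⟩, hR, hinf, hP⟩
    obtain ⟨n, hn, R', h1, h2, h3, h4⟩ := step F R hR hinf hP
    exact ⟨(n, R'), hn, h1, h2, h3, h4⟩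
  choose g hg1 hg2 hg3 hg4 hg5 using step'
  let nx : T → T := fun p => ⟨(insert (g p).1 p.1.1, (g p).2),
    (hg2 p).trans p.2.1, hg3 p, hg5 p⟩
  let t : ℕ → T := fun k => Nat.rec ⟨(∅, R₀), subset_rfl, hR₀, h0⟩ (fun _ p => nx p) k
  have ht : ∀ k, t (k + 1) = nx (t k) := fun k => rfl
  have hanti : Antitone fun k => (t k).1.2 := antitone_nat_of_succ_le fun k => by
    rw [ht]; exact hg2 (t k)
  have hlt : ∀ k, ∀ j ∈ (t (k + 1)).1.2, (g (t k)).1 < j := fun k j hj => hg4 (t k) j hj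
  refine ⟨fun k => (g (t k)).1, fun k => (t k).1.2, strictMono_nat_of_lt_succ fun k =>
    hlt k _ (hg1 (t (k + 1))), hanti, fun k => (t k).2.1, fun k => (t k).2.2.1,
    fun k => hg1 (t k), hlt, fun k => ?_⟩
  have : (t k).1.1 = (Finset.range k).image fun k => (g (t k)).1 := by
    induction k with
    | zero => rfl
    | succ k ih =>
      rw [Finset.range_add_one, Finset.image_insert, ← ih]
  rw [← this]
  exact (t k).2.2.2

/-- A pigeonhole argument along a fusion sequence: finitely many conditions `A i`, on an element
and a reservoir beyond it, either can be refuted simultaneously, or one of them holds along an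
infinite set. -/
theorem exists_forall_not_or_exists_infinite {ι : Type*} (S : Finset ι)
    {A : ι → ℕ → Set ℕ → Prop} (hA : ∀ i n R R', R' ⊆ R → A i n R → A i n R')
    {R₀ : Set ℕ} (hR₀ : R₀.Infinite) :
    (∃ n ∈ R₀, ∃ R ⊆ R₀, R.Infinite ∧ (∀ j ∈ R, n < j) ∧
      ∀ i ∈ S, ∀ R' ⊆ R, R'.Infinite → ¬ A i n R') ∨
    ∃ i ∈ S, ∃ M ⊆ R₀, M.Infinite ∧ ∀ n ∈ M, A i n {j ∈ M | n < j} := by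
  by_cases hc : ∃ n ∈ R₀, ∃ R ⊆ R₀, R.Infinite ∧ (∀ j ∈ R, n < j) ∧
      ∀ i ∈ S, ∀ R' ⊆ R, R'.Infinite → ¬ A i n R'
  · exact Or.inl hc
  right
  push Not at hc
  obtain ⟨n, R, hn, hRanti, hRsub, -, hnR, -, hP⟩ := exists_fusion
    (P := fun F R => ∀ n ∈ F, ∃ i ∈ S, A i n R) hR₀ (by simp) (by
      intro F R hR hinf hF
      obtain ⟨n, hn⟩ := hinf.nonempty
      have hinf' : (R ∩ Set.Ioi n).Infinite := by
        have := hinf.sdiff (Set.finite_Iic n)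
        refine this.mono fun j hj => ⟨hj.1, ?_⟩
        simpa using hj.2
      obtain ⟨i, hi, R', hR', hR'inf, hAi⟩ := hc n (hR hn) (R ∩ Set.Ioi n)
        (Set.inter_subset_left.trans hR) hinf' (fun j hj => hj.2)
      refine ⟨n, hn, R', hR'.trans Set.inter_subset_left, hR'inf, fun j hj => (hR' hj).2, ?_⟩
      intro m hm
      rcases Finset.mem_insert.1 hm with rfl | hm
      · exact ⟨i, hi, hAi⟩
      · obtain ⟨i', hi', hA'⟩ := hF m hm
        exact ⟨i', hi', hA _ _ _ _ (hR'.trans Set.inter_subset_left) hA'⟩)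
  have hsel : ∀ k, ∃ i : S, A i (n k) (R (k + 1)) := fun k => by
    obtain ⟨i, hi, h⟩ := hP (k + 1) (n k)
      (Finset.mem_image_of_mem _ (Finset.self_mem_range_succ k))
    exact ⟨⟨i, hi⟩, h⟩
  choose c hc using hsel
  obtain ⟨i, hi⟩ := Finite.exists_infinite_fiber c
  have hinf : (c ⁻¹' {i}).Infinite := Set.infinite_coe_iff.1 hi
  refine ⟨i, i.2, n '' (c ⁻¹' {i}), ?_, hinf.image hn.injective.injOn, ?_⟩
  · rintro _ ⟨k, -, rfl⟩
    exact hRsub k (hnR k)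
  · rintro _ ⟨k, hk, rfl⟩
    have hk' : c k = i := hk
    refine hA _ _ _ _ ?_ (hk' ▸ hc k)
    rintro _ ⟨⟨l, -, rfl⟩, hl⟩
    exact hRanti (Nat.succ_le_of_lt (hn.lt_iff_lt.1 hl)) (hnR l)

theorem infinite_sep_gt {M : Set ℕ} (hM : M.Infinite) (m : ℕ) : {j ∈ M | m < j}.Infinite :=
  (hM.sdiff (Set.finite_Iic m)).mono fun j hj => ⟨hj.1, by simpa using hj.2⟩

/-- Open sets of infinite sets of natural numbers are Ramsey. -/
theorem exists_homogeneous {U : Set ℕ → Prop}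
    (hU : ∀ L, L.Infinite → U L → ∃ m, ∀ L', L'.Infinite →
      (∀ j ≤ m, j ∈ L' ↔ j ∈ L) → U L') {R₀ : Set ℕ} (hR₀ : R₀.Infinite) :
    ∃ R ⊆ R₀, R.Infinite ∧
      ((∀ L ⊆ R, L.Infinite → U L) ∨ ∀ L ⊆ R, L.Infinite → ¬ U L) := by
  -- Acceptance in the style of Nash-Williams and Galvin–Prikry. If no infinite subset of `R₀`
  -- accepts ∅, fusion preserves the property that no infinite subset of the reservoir accepts any
  -- set of chosen elements.
  let acc : Finset ℕ → Set ℕ → Prop := fun s M =>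
    ∀ L ⊆ M, L.Infinite → (∀ i ∈ s, ∀ j ∈ L, i < j) → U (s ∪ L)
  have acc_mono : ∀ s M M', M' ⊆ M → acc s M → acc s M' := fun s M M' h hacc L hL =>
    hacc L (hL.trans h)
  by_cases hacc : ∃ R ⊆ R₀, R.Infinite ∧ acc ∅ R
  · obtain ⟨R, hR, hinf, h⟩ := hacc
    refine ⟨R, hR, hinf, Or.inl fun L hL hLinf => ?_⟩
    simpa using h L hL hLinf (by simp)
  push Not at hacc
  obtain ⟨n, R, hn, hRanti, hRsub, hRinf, hnR, -, hP⟩ := exists_fusion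
    (P := fun F R => ∀ s ⊆ F, ∀ R' ⊆ R, R'.Infinite → ¬ acc s R') hR₀
    (by
      intro s hs R' hR' hinf
      rw [Finset.subset_empty.1 hs]
      exact hacc R' hR' hinf)
    (by
      intro F R hR hinf hF
      rcases exists_forall_not_or_exists_infinite F.powerset
        (A := fun s n R => acc (insert n s) R) (fun s n R R' h => acc_mono _ _ _ h) hinf with
        ⟨n, hn, R', hR', hinf', hlt, h⟩ | ⟨s, hs, M, hM, hMinf, h⟩
      · refine ⟨n, hn, R', hR', hinf', hlt, fun s hs R'' hR'' hinf'' => ?_⟩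
        by_cases hns : n ∈ s
        · rw [← Finset.insert_erase hns]
          exact h _ (Finset.mem_powerset.2 (Finset.subset_insert_iff.1 hs)) R'' hR'' hinf''
        · exact hF s ((Finset.subset_insert_iff_of_notMem hns).1 hs) R'' (hR''.trans hR') hinf''
      · exfalso
        -- Splitting off the least element of `L` shows that `M` accepts `s` once each `insert n s`
        -- with `n ∈ M` is accepted beyond `n`.
        refine hF s (Finset.mem_powerset.1 hs) M hM hMinf fun L hL hLinf hsL => ?_
        obtain ⟨m, hmL, hm⟩ : ∃ m ∈ L, ∀ j ∈ L, m ≤ j :=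
          ⟨sInf L, Nat.sInf_mem hLinf.nonempty, fun j hj => Nat.sInf_le hj⟩
        have := h m (hL hmL) {j ∈ L | m < j} (fun j hj => ⟨hL hj.1, hj.2⟩)
          (infinite_sep_gt hLinf m) (by
            intro i hi j hj
            rcases Finset.mem_insert.1 hi with rfl | hi
            · exact hj.2
            · exact (hsL i hi m hmL).trans hj.2)
        convert this using 1
        ext j
        simp only [Set.mem_union, Finset.mem_coe, Finset.coe_insert, Set.mem_insert_iff,
          Set.mem_ofPred_eq]
        constructor
        · rintro (h | h)
          · exact Or.inl (Or.inr h)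
          · rcases (hm j h).eq_or_lt with rfl | h'
            · exact Or.inl (Or.inl rfl)
            · exact Or.inr ⟨h, h'⟩
        · rintro ((rfl | h) | h)
          · exact Or.inr hmL
          · exact Or.inl h
          · exact Or.inr h.1)
  refine ⟨Set.range n, ?_, Set.infinite_range_of_injective hn.injective, Or.inr ?_⟩
  · rintro _ ⟨k, rfl⟩
    exact hRsub k (hnR k)
  intro L hL hLinf hUL
  obtain ⟨m, hm⟩ := hU L hLinf hUL
  classical
  -- Since `k ≤ n k`, this set contains every element of `L` up to `m`. By openness a tail beyond
  -- `m` would therefore accept `s`, which the fusion excludes.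
  let s := ((Finset.range (m + 1)).image n).filter (· ∈ L)
  have hs : s ⊆ (Finset.range (m + 1)).image n := Finset.filter_subset _ _
  refine hP (m + 1) s hs {j ∈ R (m + 1) | m < j} (fun j hj => hj.1)
    (infinite_sep_gt (hRinf _) m) fun L' hL' hL'inf hsL' => hm _ ?_ ?_
  · exact hL'inf.mono Set.subset_union_right
  · intro j hj
    constructor
    · rintro (h | h)
      · exact (Finset.mem_filter.1 h).2
      · exact absurd (hL' h).2 (by omega)
    · intro h
      refine Or.inl (Finset.mem_coe.2 (Finset.mem_filter.2 ⟨?_, h⟩))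
      obtain ⟨k, rfl⟩ := hL h
      exact Finset.mem_image_of_mem _ (Finset.mem_range.2 (by have := hn.id_le k; simp at this; omega))

/-! ### Pointwise null bounded sequences in C(K) -/

section WeaklyNull

variable {K : Type*} [TopologicalSpace K]

/-- The value at `f ≥ 0` of the absolute value of the functional `φ` on `C(K, ℝ)`. -/
noncomputable def absFunctional (φ : C(K, ℝ) →L[ℝ] ℝ) (f : K → ℝ≥0) : ℝ :=
  sSup (φ '' {g | ∀ k, |g k| ≤ f k})

theorem absFunctional_le (φ : C(K, ℝ) →L[ℝ] ℝ) {f : K → ℝ≥0} {c : ℝ}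
    (h : ∀ g : C(K, ℝ), (∀ k, |g k| ≤ f k) → φ g ≤ c) : absFunctional φ f ≤ c := by
  refine csSup_le ⟨φ 0, 0, by simp, rfl⟩ ?_
  rintro _ ⟨g, hg, rfl⟩
  exact h g hg

variable [CompactSpace K]

theorem bddAbove_absFunctional (φ : C(K, ℝ) →L[ℝ] ℝ) {f : K → ℝ≥0} (hf : Continuous f) :
    BddAbove (φ '' {g | ∀ k, |g k| ≤ f k}) := by
  obtain ⟨C, hC⟩ := isCompact_univ.exists_bound_of_continuousOn
    (f := fun k => (f k : ℝ)) (NNReal.continuous_coe.comp hf).continuousOn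
  refine ⟨‖φ‖ * max C 0, ?_⟩
  rintro _ ⟨g, hg, rfl⟩
  refine (le_abs_self _).trans ((φ.le_opNorm g).trans ?_)
  refine mul_le_mul_of_nonneg_left ?_ (norm_nonneg _)
  refine (ContinuousMap.norm_le _ (le_max_right _ _)).2 fun k => ?_
  exact ((hg k).trans ((le_abs_self _).trans (hC k trivial))).trans (le_max_left _ _)

theorem le_absFunctional (φ : C(K, ℝ) →L[ℝ] ℝ) {f : K → ℝ≥0} (hf : Continuous f)
    {g : C(K, ℝ)} (hg : ∀ k, |g k| ≤ f k) : φ g ≤ absFunctional φ f :=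
  le_csSup (bddAbove_absFunctional φ hf) ⟨g, hg, rfl⟩

theorem absFunctional_nonneg (φ : C(K, ℝ) →L[ℝ] ℝ) {f : K → ℝ≥0} (hf : Continuous f) :
    0 ≤ absFunctional φ f := by
  simpa using le_absFunctional φ hf (g := 0) (by simp)

/-- Riesz decomposition: if |g| ≤ f₁ + f₂, clamping g between -f₁ and f₁ leaves a remainder
dominated by f₂. This additivity is what turns |φ| into a positive linear functional. -/
theorem absFunctional_add (φ : C(K, ℝ) →L[ℝ] ℝ) {f₁ f₂ : K → ℝ≥0} (h₁ : Continuous f₁)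
    (h₂ : Continuous f₂) :
    absFunctional φ (f₁ + f₂) = absFunctional φ f₁ + absFunctional φ f₂ := by
  apply le_antisymm
  · refine absFunctional_le φ fun g hg => ?_
    let g₁ : C(K, ℝ) := ⟨fun k => max (-(f₁ k : ℝ)) (min (g k) (f₁ k)), by fun_prop⟩
    have e : φ g = φ g₁ + φ (g - g₁) := by rw [← map_add]; simp
    rw [e]
    refine add_le_add (le_absFunctional φ h₁ fun k => ?_) (le_absFunctional φ h₂ fun k => ?_)
    · have := (f₁ k).2
      exact abs_le.2 ⟨le_max_left _ _, max_le (by simp) (min_le_right _ _)⟩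
    · have hk := abs_le.1 (hg k)
      have h1 := (f₁ k).2
      have h2 := (f₂ k).2
      simp only [Pi.add_apply, NNReal.coe_add] at hk
      change |g k - max (-(f₁ k : ℝ)) (min (g k) (f₁ k))| ≤ f₂ k
      rw [abs_le]
      rcases max_cases (-(f₁ k : ℝ)) (min (g k) (f₁ k)) with h | h <;>
        rcases min_cases (g k) (f₁ k : ℝ) with h' | h' <;> constructor <;>
        simp only [NNReal.val_eq_coe] at * <;> linarith
  · have key : ∀ g₁ : C(K, ℝ), (∀ k, |g₁ k| ≤ f₁ k) →
        φ g₁ ≤ absFunctional φ (f₁ + f₂) - absFunctional φ f₂ := by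
      intro g₁ hg₁
      have : absFunctional φ f₂ ≤ absFunctional φ (f₁ + f₂) - φ g₁ := by
        refine absFunctional_le φ fun g₂ hg₂ => ?_
        have := le_absFunctional φ (h₁.add h₂) (g := g₁ + g₂) fun k => by
          simpa using (abs_add_le _ _).trans (add_le_add (hg₁ k) (hg₂ k))
        rw [map_add] at this
        change φ g₁ + φ g₂ ≤ absFunctional φ (f₁ + f₂) at this
        linarith
      linarith
    linarith [absFunctional_le φ key]

theorem absFunctional_smul (φ : C(K, ℝ) →L[ℝ] ℝ) (c : ℝ≥0) {f : K → ℝ≥0}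
    (hf : Continuous f) : absFunctional φ (c • f) = c * absFunctional φ f := by
  rcases eq_or_ne c 0 with rfl | hc
  · simp only [NNReal.coe_zero, zero_mul]
    refine le_antisymm (absFunctional_le φ fun g hg => ?_)
      (absFunctional_nonneg φ (continuous_const.smul hf))
    have : g = 0 := by
      ext k
      simpa using hg k
    simp [this]
  have hc' : (0 : ℝ) < c := by exact_mod_cast pos_iff_ne_zero.2 hc
  apply le_antisymm
  · refine absFunctional_le φ fun g hg => ?_
    have := le_absFunctional φ hf (g := (c : ℝ)⁻¹ • g) fun k => by
      have := hg k
      simp only [Pi.smul_apply, smul_eq_mul, NNReal.coe_mul] at this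
      simp only [ContinuousMap.coe_smul, Pi.smul_apply, smul_eq_mul, abs_mul, abs_inv,
        NNReal.abs_eq]
      rwa [inv_mul_le_iff₀ hc']
    rw [map_smul, smul_eq_mul, inv_mul_le_iff₀ hc'] at this
    exact this
  · rw [← le_div_iff₀' hc']
    refine absFunctional_le φ fun g hg => ?_
    rw [le_div_iff₀' hc']
    have := le_absFunctional φ (continuous_const.smul hf) (f := c • f) (g := (c : ℝ) • g) fun k => by
      simpa [abs_mul] using mul_le_mul_of_nonneg_left (hg k) hc'.le
    simpa using this

/-- The absolute value of a functional on `C(K, ℝ)`, as a functional on the positive cone. -/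
noncomputable def absFunctionalLinear (φ : C(K, ℝ) →L[ℝ] ℝ) :
    CompactlySupportedContinuousMap K ℝ≥0 →ₗ[ℝ≥0] ℝ≥0 where
  toFun f := ⟨absFunctional φ f, absFunctional_nonneg φ f.continuous⟩
  map_add' f₁ f₂ := NNReal.eq (absFunctional_add φ f₁.continuous f₂.continuous)
  map_smul' c f := NNReal.eq (absFunctional_smul φ c f.continuous)

/-- A bounded sequence in `C(K, ℝ)` which tends to zero pointwise is weakly null. -/
theorem tendsto_functional_of_tendsto_apply [T2Space K] {g : ℕ → C(K, ℝ)} {C : ℝ≥0}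
    (hC : ∀ n k, |g n k| ≤ C) (hg : ∀ k, Tendsto (fun n => g n k) atTop (𝓝 0))
    (φ : C(K, ℝ) →L[ℝ] ℝ) : Tendsto (fun n => φ (g n)) atTop (𝓝 0) := by
  let _ : MeasurableSpace K := borel K
  have _ : BorelSpace K := ⟨rfl⟩
  let F : ℕ → CompactlySupportedContinuousMap K ℝ≥0 := fun n =>
    CompactlySupportedContinuousMap.continuousMapEquiv ⟨fun k => ‖g n k‖₊, by fun_prop⟩
  let D : CompactlySupportedContinuousMap K ℝ≥0 :=
    CompactlySupportedContinuousMap.continuousMapEquiv (ContinuousMap.const K C)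
  have hF : ∀ n k, ((F n k : ℝ≥0) : ℝ) = |g n k| := fun n k => rfl
  -- By Riesz–Markov |φ| is integration against a measure, finite on constants, and |φ(gₙ)| ≤
  -- |φ|(|gₙ|); dominated convergence finishes.
  let Λ := absFunctionalLinear φ
  have hint := NNRealRMK.lintegral_rieszMeasure Λ
  have hlim : Tendsto (fun n => ∫⁻ k, (F n k : ℝ≥0∞) ∂NNRealRMK.rieszMeasure Λ) atTop
      (𝓝 (∫⁻ _, 0 ∂NNRealRMK.rieszMeasure Λ)) := by
    refine MeasureTheory.tendsto_lintegral_of_dominated_convergence (fun k => (D k : ℝ≥0∞))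
      (fun n => (F n).continuous.measurable.coe_nnreal_ennreal) (fun n => ?_) ?_ ?_
    · refine Eventually.of_forall fun k => ENNReal.coe_le_coe.2 ?_
      exact NNReal.coe_le_coe.1 (hC n k)
    · rw [hint]
      exact ENNReal.coe_ne_top
    · refine Eventually.of_forall fun k => ?_
      have : Tendsto (fun n => F n k) atTop (𝓝 0) := by
        rw [← NNReal.tendsto_coe]
        simpa [hF] using (hg k).abs
      rw [← ENNReal.coe_zero]
      exact ENNReal.tendsto_coe.2 this
  simp only [hint, MeasureTheory.lintegral_zero] at hlim
  have hlim' : Tendsto (fun n => (Λ (F n) : ℝ)) atTop (𝓝 0) := by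
    rw [← ENNReal.coe_zero, ENNReal.tendsto_coe] at hlim
    simpa using NNReal.tendsto_coe.2 hlim
  refine squeeze_zero_norm (fun n => abs_le.2 ⟨?_, ?_⟩) hlim'
  · have := le_absFunctional φ (F n).continuous (g := -g n) (fun k => by simp [hF])
    rw [map_neg] at this
    change -φ (g n) ≤ Λ (F n) at this
    linarith
  · exact le_absFunctional φ (F n).continuous (fun k => (hF n k).ge)

end WeaklyNull

/-! ### Almost monotone basic subsequences of weakly null sequences -/

/-- Diagonal selection, with `F` the set of terms already chosen at stage `k`. Asking only for
frequent validity allows a condition coming from a cluster point to be combined with eventual ones.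
-/
theorem exists_strictMono_of_frequently {Q : ℕ → Finset ℕ → ℕ → Prop}
    (hQ : ∀ k F, ∃ᶠ n in atTop, Q k F n) :
    ∃ φ : ℕ → ℕ, StrictMono φ ∧ ∀ k, Q k ((Finset.range k).image φ) (φ k) := by
  have h : ∀ k (F : Finset ℕ), ∃ n, F.sup id < n ∧ Q k F n := fun k F => by
    obtain ⟨n, hn, h⟩ := frequently_atTop.1 (hQ k F) (F.sup id + 1)
    exact ⟨n, hn, h⟩
  choose g hg hgQ using h
  let F : ℕ → Finset ℕ := fun k => Nat.rec ∅ (fun k F => insert (g k F) F) k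
  have hF : ∀ k, F (k + 1) = insert (g k (F k)) (F k) := fun _ => rfl
  have hFim : ∀ k, F k = (Finset.range k).image fun k => g k (F k) := fun k => by
    induction k with
    | zero => rfl
    | succ k ih => rw [hF, Finset.range_add_one, Finset.image_insert, ← ih]
  refine ⟨fun k => g k (F k), strictMono_nat_of_lt_succ fun k => ?_, fun k => ?_⟩
  · have h1 := hg (k + 1) (F (k + 1))
    have h2 : g k (F k) ≤ (F (k + 1)).sup id :=
      Finset.le_sup (f := id) (by rw [hF]; exact Finset.mem_insert_self _ _)
    exact h2.trans_lt h1
  · rw [← hFim]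
    exact hgQ k _

theorem sum_half_pow_succ_le_one (s : Finset ℕ) : ∑ l ∈ s, (1 / 2 : ℝ) ^ (l + 1) ≤ 1 := by
  have h : HasSum (fun l : ℕ => (1 / 2 : ℝ) ^ (l + 1)) 1 := by
    simpa [pow_succ] using hasSum_geometric_two.mul_right (1 / 2 : ℝ)
  exact sum_le_hasSum s (fun _ _ => by positivity) h

section Subsequences

variable {X : Type u} [NormedAddCommGroup X] [NormedSpace ℝ X]

/-- The coordinates of finite linear combinations are bounded by `C` times the norm. -/
def CoordBound (x : ℕ → X) (C : ℝ) : Prop :=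
  ∀ (a : ℕ →₀ ℝ) (i : ℕ), |a i| ≤ C * ‖a.sum fun i c => c • x i‖

/-- The projections onto initial segments are bounded by `C` on finite linear combinations. -/
def TruncBound (x : ℕ → X) (C : ℝ) : Prop :=
  ∀ (a : ℕ →₀ ℝ) (n : ℕ),
    ‖∑ i ∈ Finset.range n, a i • x i‖ ≤ C * ‖a.sum fun i c => c • x i‖

theorem CoordBound.comp {x : ℕ → X} {C : ℝ} (h : CoordBound x C) {φ : ℕ → ℕ}
    (hφ : StrictMono φ) : CoordBound (x ∘ φ) C := fun a i => by
  have := h (a.mapDomain φ) (φ i)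
  rw [Finsupp.mapDomain_apply hφ.injective,
    Finsupp.sum_mapDomain_index_inj hφ.injective] at this
  exact this

theorem TruncBound.comp {x : ℕ → X} {C : ℝ} (h : TruncBound x C) {φ : ℕ → ℕ}
    (hφ : StrictMono φ) : TruncBound (x ∘ φ) C := fun a n => by
  have := h (a.mapDomain φ) (φ n)
  rw [Finsupp.sum_mapDomain_index_inj hφ.injective] at this
  refine Eq.trans_le (congrArg norm ?_) this
  symm
  rw [← Finset.sum_image (s := Finset.range n) (g := φ)
    (f := fun j => a.mapDomain φ j • x j) hφ.injective.injOn |>.trans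
    (Finset.sum_congr rfl fun i _ => by
      rw [Finsupp.mapDomain_apply hφ.injective]; rfl)]
  symm
  refine Finset.sum_subset (fun j hj => ?_) fun j hj hj' => ?_
  · obtain ⟨i, hi, rfl⟩ := Finset.mem_image.1 hj
    exact Finset.mem_range.2 (hφ (Finset.mem_range.1 hi))
  · by_cases hr : j ∈ Set.range φ
    · obtain ⟨i, rfl⟩ := hr
      exact absurd (Finset.mem_image_of_mem φ
        (Finset.mem_range.2 (hφ.lt_iff_lt.1 (Finset.mem_range.1 hj)))) hj'
    · rw [Finsupp.mapDomain_of_notMem_range _ _ hr, zero_smul]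

theorem NormalizedWeaklyNull.comp {x : ℕ → X} (h : NormalizedWeaklyNull x) {φ : ℕ → ℕ}
    (hφ : StrictMono φ) : NormalizedWeaklyNull (x ∘ φ) :=
  ⟨fun n => h.1 (φ n), fun f => (h.2 f).comp hφ.tendsto_atTop⟩

/-- Banach–Alaoglu. Since `X` need not be separable, it yields a weak-* cluster point and not a
convergent subsequence. -/
theorem exists_cluster_functional {f : ℕ → X →L[ℝ] ℝ} (hf : ∀ n, ‖f n‖ ≤ 1) (x : ℕ → X) :
    ∃ g : X →L[ℝ] ℝ, ∀ (F : Finset ℕ) (ε : ℝ), 0 < ε →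
      ∃ᶠ n in atTop, ∀ i ∈ F, |f n (x i) - g (x i)| < ε := by
  obtain ⟨g, -, hg⟩ := (WeakDual.isCompact_closedBall (𝕜 := ℝ) (0 : StrongDual ℝ X) 1).exists_mapClusterPt
    (f := atTop) (u := fun n : ℕ => StrongDual.toWeakDual (f n)) (by
      rw [le_principal_iff]
      refine mem_map.2 (univ_mem' fun n => ?_)
      simpa using hf n)
  refine ⟨WeakDual.toStrongDual g, fun F ε hε => ?_⟩
  have hopen : (⋂ i ∈ F, {h : WeakDual ℝ X | |h (x i) - g (x i)| < ε}) ∈ 𝓝 g := by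
    refine (Filter.biInter_finset_mem F).2 fun i _ => ?_
    have hc : Continuous fun h : WeakDual ℝ X => |h (x i) - g (x i)| :=
      ((WeakDual.eval_continuous (x i)).sub continuous_const).abs
    exact (isOpen_lt hc continuous_const).mem_nhds (by simpa using hε)
  refine (mapClusterPt_iff_frequently.1 hg _ hopen).mono fun n hn i hi => ?_
  exact Set.mem_iInter₂.1 hn i hi

/-- Norming functionals of the xₙ become almost biorthogonal along a subsequence: later vectors are
small by weak nullness, earlier ones because the functional is close to the cluster point `g`,
itself small there. Testing against the functional at a largest coordinate gives (1 - θ)|a k| ≤ ‖v‖,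
and θ = η/(1+η) makes 1 - θ = 1/(1+η). -/
theorem exists_coordBound {x : ℕ → X} (hx : NormalizedWeaklyNull x) {η : ℝ} (hη : 0 < η) :
    ∃ φ : ℕ → ℕ, StrictMono φ ∧ CoordBound (x ∘ φ) (1 + η) := by
  choose f hf1 hfx using fun n => exists_dual_vector'' ℝ (x n)
  simp only [hx.1, RCLike.ofReal_one] at hfx
  obtain ⟨g, hg⟩ := exists_cluster_functional hf1 x
  set θ : ℝ := η / (1 + η) with hθ
  have hθ0 : 0 < θ := by positivity
  have hsmall : ∀ (h : X →L[ℝ] ℝ) (k : ℕ), ∀ᶠ n in atTop, |h (x n)| < θ / 2 * (1 / 2) ^ (k + 1) :=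
    fun h k => by
      have := (hx.2 h).abs
      rw [abs_zero] at this
      exact this.eventually_lt_const (by positivity)
  obtain ⟨φ, hφ, hQ⟩ := exists_strictMono_of_frequently
    (Q := fun k F n => (∀ j ∈ F, |f n (x j) - g (x j)| < θ / 2 * (1 / 2) ^ (k + 1)) ∧
      |g (x n)| < θ / 2 * (1 / 2) ^ (k + 1) ∧
      ∀ j ∈ F, |f j (x n)| < θ / 2 * (1 / 2) ^ (k + 1)) (fun k F => by
        refine (hg F _ (by positivity)).and_eventually ((hsmall g k).and ?_)
        exact (F.eventually_all).2 fun j _ => hsmall (f j) k)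
  have hoff : ∀ k l, l ≠ k → |f (φ k) (x (φ l))| ≤ θ * (1 / 2) ^ (l + 1) := by
    intro k l hkl
    rcases hkl.lt_or_gt with h | h
    · have h1 := (hQ k).1 (φ l) (Finset.mem_image_of_mem φ (Finset.mem_range.2 h))
      have h2 := (hQ l).2.1
      have h3 : (1 / 2 : ℝ) ^ (k + 1) ≤ (1 / 2) ^ (l + 1) :=
        pow_le_pow_of_le_one (by norm_num) (by norm_num) (by omega)
      have h4 : |f (φ k) (x (φ l))| ≤ |f (φ k) (x (φ l)) - g (x (φ l))| + |g (x (φ l))| := by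
        simpa using abs_add_le (f (φ k) (x (φ l)) - g (x (φ l))) (g (x (φ l)))
      nlinarith
    · have h1 := (hQ l).2.2 (φ k) (Finset.mem_image_of_mem φ (Finset.mem_range.2 h))
      have : (0 : ℝ) < (1 / 2) ^ (l + 1) := by positivity
      nlinarith
  refine ⟨φ, hφ, fun a i => ?_⟩
  rcases eq_or_ne a 0 with rfl | ha
  · simp
  obtain ⟨k, hk, hmax⟩ := a.support.exists_max_image (fun i => |a i|)
    (Finsupp.support_nonempty_iff.2 ha)
  have hmax' : ∀ i, |a i| ≤ |a k| := fun i => by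
    by_cases hi : i ∈ a.support
    · exact hmax i hi
    · rw [Finsupp.notMem_support_iff.1 hi, abs_zero]
      positivity
  refine (hmax' i).trans ?_
  set v := a.sum fun i c => c • (x ∘ φ) i with hv
  have hval : f (φ k) v = a k + ∑ l ∈ a.support.erase k, a l * f (φ k) (x (φ l)) := by
    rw [hv, Finsupp.sum, map_sum, ← Finset.add_sum_erase _ _ hk]
    simp [hfx]
  have hsum : |∑ l ∈ a.support.erase k, a l * f (φ k) (x (φ l))| ≤ θ * |a k| := by
    calc |∑ l ∈ a.support.erase k, a l * f (φ k) (x (φ l))|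
        ≤ ∑ l ∈ a.support.erase k, |a l * f (φ k) (x (φ l))| := Finset.abs_sum_le_sum_abs _ _
      _ ≤ ∑ l ∈ a.support.erase k, (θ * |a k|) * (1 / 2) ^ (l + 1) := by
          refine Finset.sum_le_sum fun l hl => ?_
          rw [abs_mul]
          calc |a l| * |f (φ k) (x (φ l))| ≤ |a k| * (θ * (1 / 2) ^ (l + 1)) :=
                mul_le_mul (hmax' l) (hoff k l (Finset.ne_of_mem_erase hl)) (abs_nonneg _)
                  (abs_nonneg _)
            _ = _ := by ring
      _ ≤ θ * |a k| * 1 := by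
          rw [← Finset.mul_sum]
          exact mul_le_mul_of_nonneg_left (sum_half_pow_succ_le_one _) (by positivity)
      _ = θ * |a k| := mul_one _
  have hnorm : |f (φ k) v| ≤ ‖v‖ := by
    simpa using (f (φ k)).le_of_opNorm_le (hf1 _) v
  have h1 : |a k| ≤ ‖v‖ + θ * |a k| := by
    have : |a k| ≤ |f (φ k) v| + |∑ l ∈ a.support.erase k, a l * f (φ k) (x (φ l))| := by
      have e : a k = f (φ k) v - ∑ l ∈ a.support.erase k, a l * f (φ k) (x (φ l)) := by
        rw [hval]; ring
      rw [e]
      exact abs_sub _ _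
    linarith
  have h2 : (1 + η) * θ = η := by rw [hθ]; field_simp
  have h3 := mul_le_mul_of_nonneg_left h1 (show 0 ≤ 1 + η by positivity)
  rw [mul_add, ← mul_assoc (1 + η) θ, h2] at h3
  linarith

/-- A weakly null sequence is eventually almost orthogonal to a given finite-dimensional space. -/
theorem eventually_norm_le_norm_add {x : ℕ → X} (hx : NormalizedWeaklyNull x)
    (V : Submodule ℝ X) [FiniteDimensional ℝ V] {θ : ℝ} (hθ : 1 < θ) :
    ∀ᶠ n in atTop, ∀ v ∈ V, ∀ t : ℝ, ‖v‖ ≤ θ * ‖v + t • x n‖ := by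
  -- If |t| ≥ 2‖v‖ the triangle inequality suffices. Otherwise one ε is lost to a finite net of
  -- norming functionals on the unit sphere of `V`, and 2ε to the term in `x n`.
  set ε : ℝ := (1 - θ⁻¹) / 3 with hε
  have hθ' : θ⁻¹ < 1 := inv_lt_one_of_one_lt₀ hθ
  have hε0 : 0 < ε := by rw [hε]; linarith
  choose f hf1 hfx using fun v : V => exists_dual_vector'' ℝ (v : X)
  obtain ⟨T, -, hT⟩ := (isCompact_sphere (0 : V) 1).elim_nhds_subcover
    (fun v => {w : V | 1 - ε < f v w}) (fun v hv => by
      refine (isOpen_lt continuous_const ((f v).continuous.comp continuous_subtype_val)).mem_nhds ?_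
      have : ‖(v : X)‖ = 1 := by simpa using hv
      change 1 - ε < f v v
      rw [hfx v, this]
      simpa using hε0)
  have hev : ∀ᶠ n in atTop, ∀ w ∈ T, |f w (x n)| < ε := by
    refine (T.eventually_all).2 fun w _ => ?_
    have := (hx.2 (f w)).abs
    rw [abs_zero] at this
    exact this.eventually_lt_const hε0
  filter_upwards [hev] with n hn v hv t
  have key : θ⁻¹ * ‖v‖ ≤ ‖v + t • x n‖ := by
    by_cases ht : 2 * ‖v‖ ≤ |t|
    · have h1 : ‖t • x n‖ - ‖v‖ ≤ ‖v + t • x n‖ := by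
        rw [add_comm]; simpa using norm_sub_norm_le (t • x n) (-v)
      rw [norm_smul, hx.1, mul_one, Real.norm_eq_abs] at h1
      nlinarith [norm_nonneg v]
    · push Not at ht
      have hvpos : 0 < ‖v‖ := by
        have := abs_nonneg t
        linarith
      have hmem : (‖v‖⁻¹ • (⟨v, hv⟩ : V)) ∈ Metric.sphere (0 : V) 1 := by
        rw [mem_sphere_zero_iff_norm, norm_smul, norm_inv, norm_norm]
        exact inv_mul_cancel₀ hvpos.ne'
      obtain ⟨w, hw, hfw⟩ := Set.mem_iUnion₂.1 (hT hmem)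
      have hfw' : 1 - ε < ‖v‖⁻¹ * f w v := by simpa using hfw
      rw [lt_inv_mul_iff₀ hvpos] at hfw'
      have h1 : f w (v + t • x n) ≤ ‖v + t • x n‖ :=
        (le_abs_self _).trans (by simpa using (f w).le_of_opNorm_le (hf1 w) (v + t • x n))
      rw [map_add, map_smul, smul_eq_mul] at h1
      have h2 : |t * f w (x n)| ≤ 2 * ‖v‖ * ε := by
        rw [abs_mul]
        exact mul_le_mul ht.le (hn w hw).le (abs_nonneg _) (by positivity)
      have h3 := neg_abs_le (t * f w (x n))
      have h4 : θ⁻¹ = 1 - 3 * ε := by rw [hε]; ring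
      rw [h4]
      nlinarith
  rwa [inv_mul_le_iff₀ (by linarith)] at key

/-- With constants `c k` increasing from 1 and bounded by 1 + η, each new term is chosen almost
orthogonal to the span of its predecessors with ratio `c (k + 1) / c k`. The product of `c k` with
the norm of the k-th partial sum is then monotone. -/
theorem exists_truncBound {x : ℕ → X} (hx : NormalizedWeaklyNull x) {η : ℝ} (hη : 0 < η) :
    ∃ φ : ℕ → ℕ, StrictMono φ ∧ TruncBound (x ∘ φ) (1 + η) := by
  set c : ℕ → ℝ := fun k => 1 + η * (1 - (1 / 2) ^ k) with hc
  have hpow : ∀ k : ℕ, (0 : ℝ) < (1 / 2) ^ k ∧ (1 / 2 : ℝ) ^ k ≤ 1 := fun k =>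
    ⟨by positivity, pow_le_one₀ (by norm_num) (by norm_num)⟩
  have hc1 : ∀ k, 1 ≤ c k := fun k => by
    have := hpow k
    simp only [hc]; nlinarith
  have hc2 : ∀ k, c k ≤ 1 + η := fun k => by
    have := hpow k
    simp only [hc]; nlinarith
  have hcs : ∀ k, c k < c (k + 1) := fun k => by
    have := hpow k
    simp only [hc, pow_succ]; nlinarith
  obtain ⟨φ, hφ, hQ⟩ := exists_strictMono_of_frequently
    (Q := fun k F n => ∀ v ∈ Submodule.span ℝ (x '' F), ∀ t : ℝ,
      ‖v‖ ≤ c (k + 1) / c k * ‖v + t • x n‖) (fun k F => by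
        have : FiniteDimensional ℝ (Submodule.span ℝ (x '' (F : Set ℕ))) :=
          FiniteDimensional.span_of_finite ℝ (F.finite_toSet.image x)
        refine (eventually_norm_le_norm_add hx _ ?_).frequently
        rw [one_lt_div (by linarith [hc1 k])]
        exact hcs k)
  refine ⟨φ, hφ, fun a n => ?_⟩
  let S : ℕ → X := fun n => ∑ i ∈ Finset.range n, a i • (x ∘ φ) i
  have hmono : Monotone fun k => c k * ‖S k‖ := by
    refine monotone_nat_of_le_succ fun k => ?_
    have hmem : S k ∈ Submodule.span ℝ (x '' ((Finset.range k).image φ : Finset ℕ)) := by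
      refine Submodule.sum_mem _ fun i hi => Submodule.smul_mem _ _ (Submodule.subset_span ?_)
      exact ⟨φ i, Finset.mem_coe.2 (Finset.mem_image_of_mem φ hi), rfl⟩
    have h := hQ k (S k) hmem (a k)
    have hS : S (k + 1) = S k + a k • x (φ k) := Finset.sum_range_succ _ _
    rw [← hS, div_mul_eq_mul_div, le_div_iff₀ (by linarith [hc1 k])] at h
    linarith
  obtain ⟨m, hm⟩ : ∃ m, a.support ⊆ Finset.range m :=
    ⟨a.support.sup id + 1, fun i hi => Finset.mem_range.2
      (Nat.lt_succ_of_le (Finset.le_sup (f := id) hi))⟩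
  have hSm : S (max n m) = a.sum fun i c => c • (x ∘ φ) i := by
    rw [Finsupp.sum]
    symm
    refine Finset.sum_subset (hm.trans (Finset.range_mono (le_max_right _ _))) fun i _ hi => ?_
    rw [Finsupp.notMem_support_iff.1 hi, zero_smul]
  have h := hmono (le_max_left n m)
  simp only [hSm] at h
  change ‖S n‖ ≤ _
  nlinarith [norm_nonneg (S n), hc1 n, hc2 (max n m),
    norm_nonneg (a.sum fun i c => c • (x ∘ φ) i)]

/-- A normalized weakly null sequence has a subsequence which is almost monotone basic and has
coordinate functionals of norm close to one. -/
theorem exists_coordBound_truncBound {x : ℕ → X} (hx : NormalizedWeaklyNull x) {η : ℝ}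
    (hη : 0 < η) : ∃ φ : ℕ → ℕ, StrictMono φ ∧ CoordBound (x ∘ φ) (1 + η) ∧
      TruncBound (x ∘ φ) (1 + η) := by
  obtain ⟨φ, hφ, h1⟩ := exists_coordBound hx hη
  obtain ⟨ψ, hψ, h2⟩ := exists_truncBound (hx.comp hφ) hη
  exact ⟨φ ∘ ψ, hφ.comp hψ, h1.comp hψ, h2⟩

/-- On an infinite set of indices, the functionals in the unit ball are small somewhere on an
initial segment which does not depend on the functional. -/
theorem exists_forall_exists_abs_le {x : ℕ → X} (hx : NormalizedWeaklyNull x) {M : Set ℕ}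
    (hM : M.Infinite) {ε : ℝ} (hε : 0 < ε) :
    ∃ J, ∀ f : X →L[ℝ] ℝ, ‖f‖ ≤ 1 → ∃ n ∈ M, n ≤ J ∧ |f (x n)| ≤ ε := by
  by_contra! hcon
  choose f hf1 hf using hcon
  obtain ⟨g, hg⟩ := exists_cluster_functional hf1 x
  have hsmall : ∀ᶠ n in atTop, |g (x n)| < ε / 2 := by
    have := (hx.2 g).abs
    rw [abs_zero] at this
    exact this.eventually_lt_const (by positivity)
  obtain ⟨n, hn, hnM⟩ := (hsmall.and_frequently (Nat.frequently_atTop_iff_infinite.2 hM)).exists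
  obtain ⟨J, hJ, hnJ⟩ := ((hg {n} (ε / 2) (by positivity)).and_eventually
    (eventually_ge_atTop n)).exists
  have h1 := hJ n (Finset.mem_singleton_self n)
  have h2 := hf J n hnM hnJ
  have h3 : |f J (x n)| ≤ |f J (x n) - g (x n)| + |g (x n)| := by
    simpa using abs_add_le (f J (x n) - g (x n)) (g (x n))
  linarith

end Subsequences

/-! ### Functionals almost vanishing off their index sets -/

section InitialSegments

variable {α : Type*}

open scoped Classical in
/-- The elements of `Z` up to `m`. -/
noncomputable def segUpTo (Z : Set ℕ) (m : ℕ) : Finset ℕ :=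
  (Finset.range (m + 1)).filter (· ∈ Z)

theorem mem_segUpTo {Z : Set ℕ} {m j : ℕ} : j ∈ segUpTo Z m ↔ j ≤ m ∧ j ∈ Z := by
  simp [segUpTo]

/-- The least `m` for which `G` is non-empty at the initial segment of `Z` up to `m`. -/
noncomputable def frontIndex (G : Finset ℕ → Set α) (Z : Set ℕ) : ℕ :=
  sInf {m | (G (segUpTo Z m)).Nonempty}

/-- The shortest initial segment of `Z` at which `G` is non-empty. -/
noncomputable def frontSeg (G : Finset ℕ → Set α) (Z : Set ℕ) : Finset ℕ :=
  segUpTo Z (frontIndex G Z)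

/-- The shortest good initial segment depends only on the elements up to `frontIndex G Z`.
Properties of it are thus open conditions on `Z`, to which the Ramsey theorem applies. -/
theorem frontSeg_congr {G : Finset ℕ → Set α} {Z Z' : Set ℕ} (h : (G (frontSeg G Z)).Nonempty)
    (hZ : ∀ j ≤ frontIndex G Z, j ∈ Z' ↔ j ∈ Z) : frontSeg G Z' = frontSeg G Z := by
  have hseg : ∀ m ≤ frontIndex G Z, segUpTo Z' m = segUpTo Z m := fun m hm => by
    ext j
    simp only [mem_segUpTo]
    exact and_congr_right fun hj => hZ j (hj.trans hm)
  have h1 : (G (segUpTo Z' (frontIndex G Z))).Nonempty := by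
    rwa [hseg _ le_rfl]
  have h2 : frontIndex G Z' ≤ frontIndex G Z := Nat.sInf_le h1
  have h3 : (G (segUpTo Z' (frontIndex G Z'))).Nonempty :=
    Nat.sInf_mem (s := {m | (G (segUpTo Z' m)).Nonempty}) ⟨_, h1⟩
  rw [hseg _ h2] at h3
  have h4 : frontIndex G Z' = frontIndex G Z := le_antisymm h2 (Nat.sInf_le h3)
  rw [frontSeg, h4, hseg _ le_rfl, frontSeg]

theorem frontSeg_nonempty {G : Finset ℕ → Set α} (hmono : Monotone G) {Z : Set ℕ}
    (h : ∃ s : Finset ℕ, ↑s ⊆ Z ∧ (G s).Nonempty) : (G (frontSeg G Z)).Nonempty := by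
  obtain ⟨s, hs, hne⟩ := h
  refine Nat.sInf_mem (s := {m | (G (segUpTo Z m)).Nonempty}) ⟨s.sup id, hne.mono (hmono ?_)⟩
  exact fun j hj => mem_segUpTo.2 ⟨Finset.le_sup (f := id) hj, hs hj⟩

end InitialSegments

section

variable {X : Type u} [NormedAddCommGroup X] [NormedSpace ℝ X]

/-- If every infinite set contains a finite set `s` with a functional in `G s`, then, inside a
suitable infinite set `N`, the functional can be taken almost zero on the elements of `N` which are
not in `s` and do not lie beyond `s`. -/
theorem exists_infinite_forall_subset_sum_le {x : ℕ → X} (hx : NormalizedWeaklyNull x)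
    {G : Finset ℕ → Set (X →L[ℝ] ℝ)} (hG : ∀ s, ∀ f ∈ G s, ‖f‖ ≤ 1) (hmono : Monotone G)
    (hne : ∀ L : Set ℕ, L.Infinite → ∃ s : Finset ℕ, ↑s ⊆ L ∧ (G s).Nonempty)
    {ε : ℝ} (hε : 0 < ε) :
    ∃ N : Set ℕ, N.Infinite ∧ ∀ L ⊆ N, L.Infinite → ∃ s : Finset ℕ, ↑s ⊆ L ∧ ∃ f ∈ G s,
      ∀ T : Finset ℕ, ↑T ⊆ N → Disjoint T s → (∀ i ∈ T, ∃ j ∈ s, i ≤ j) →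
        ∑ i ∈ T, |f (x i)| ≤ ε := by
  have hfront : ∀ Z : Set ℕ, Z.Infinite → (G (frontSeg G Z)).Nonempty := fun Z hZ =>
    frontSeg_nonempty hmono (hne Z hZ)
  have hunion : ∀ (s : Finset ℕ) {L : Set ℕ}, L.Infinite → ((s : Set ℕ) ∪ L).Infinite :=
    fun s L hL => hL.mono Set.subset_union_right
  -- Here `s` is the trace on `F` of the set `s ∪ L`, and smallness is required on the rejected
  -- elements `F \ s`. Each new element may use ε/2^(|F|+1), so the total stays below ε.
  obtain ⟨n, R, hn, hRanti, -, hRinf, hnR, hlt, hP⟩ := exists_fusion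
    (P := fun F R => ∀ s ⊆ F, ∀ L ⊆ R, L.Infinite → ∃ f ∈ G (frontSeg G (s ∪ L)),
      ∑ i ∈ F \ s, |f (x i)| ≤ ε * (1 - (1 / 2) ^ F.card)) Set.infinite_univ
    (by
      intro s hs L _ hL
      obtain ⟨f, hf⟩ := hfront _ (hunion s hL)
      exact ⟨f, hf, by simp⟩)
    (by
      intro F R _ hinf hF
      set ε' : ℝ := ε * (1 / 2) ^ (F.card + 1) with hε'
      have hε'0 : 0 < ε' := by positivity
      let U : Finset ℕ → ℕ → Set ℕ → Prop := fun s n L => ∃ f ∈ G (frontSeg G (s ∪ L)),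
        ∑ i ∈ F \ s, |f (x i)| ≤ ε * (1 - (1 / 2) ^ F.card) ∧ |f (x n)| ≤ ε'
      have hUopen : ∀ s n L, L.Infinite → U s n L → ∃ m, ∀ L' : Set ℕ, L'.Infinite →
          (∀ j ≤ m, j ∈ L' ↔ j ∈ L) → U s n L' := by
        rintro s n L hL ⟨f, hf, h⟩
        refine ⟨frontIndex G (s ∪ L), fun L' _ hLL' => ⟨f, ?_, h⟩⟩
        rwa [frontSeg_congr (Z' := s ∪ L') ⟨f, hf⟩ fun j hj => or_congr_right (hLL' j hj)]
      rcases exists_forall_not_or_exists_infinite F.powerset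
        (A := fun s n R => ∀ L ⊆ R, L.Infinite → ¬ U s n L)
        (fun s n R R' h hA L hL => hA L (hL.trans h)) hinf with
        ⟨n, hn, R₁, hR₁, hinf₁, hlt, h⟩ | ⟨s, hs, M, hM, hMinf, h⟩
      -- For each of the finitely many `s`, a homogeneous set exists and its negative alternative is
      -- excluded by `h`.
      · have hpos : ∀ S ⊆ F.powerset, ∃ R₂ ⊆ R₁, R₂.Infinite ∧
            ∀ s ∈ S, ∀ L ⊆ R₂, L.Infinite → U s n L := by
          intro S
          induction S using Finset.induction_on with
          | empty => exact fun _ => ⟨R₁, subset_rfl, hinf₁, by simp⟩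
          | insert s S _ ih =>
            intro hS
            obtain ⟨R₂, hR₂, hinf₂, h₂⟩ := ih ((Finset.subset_insert _ _).trans hS)
            obtain ⟨R₃, hR₃, hinf₃, h₃ | h₃⟩ := exists_homogeneous (hUopen s n) hinf₂
            · refine ⟨R₃, hR₃.trans hR₂, hinf₃, fun t ht => ?_⟩
              rcases Finset.mem_insert.1 ht with rfl | ht
              · exact h₃
              · exact fun L hL => h₂ t ht L (hL.trans hR₃)
            · exact absurd h₃ (h s (hS (Finset.mem_insert_self _ _)) R₃ (hR₃.trans hR₂) hinf₃)
        obtain ⟨R₂, hR₂, hinf₂, h₂⟩ := hpos _ subset_rfl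
        refine ⟨n, hn, R₂, hR₂.trans hR₁, hinf₂, fun j hj => hlt j (hR₂ hj),
          fun s hs L hL hLinf => ?_⟩
        by_cases hnF : n ∈ F
        · rw [Finset.insert_eq_of_mem hnF] at hs ⊢
          exact hF s hs L (hL.trans (hR₂.trans hR₁)) hLinf
        rw [Finset.card_insert_of_notMem hnF]
        have hpow : (1 / 2 : ℝ) ^ (F.card + 1) = (1 / 2) ^ F.card / 2 := by rw [pow_succ]; ring
        have hpow0 : (0 : ℝ) < (1 / 2) ^ F.card := by positivity
        by_cases hns : n ∈ s
        -- If `n` is accepted, it may be moved from `s` to the infinite part, and the old condition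
        -- applies unchanged.
        · obtain ⟨f, hf, hsum⟩ := hF (s.erase n) (Finset.subset_insert_iff.1 hs) (insert n L)
            (Set.insert_subset hn (hL.trans (hR₂.trans hR₁))) (hLinf.mono (Set.subset_insert _ _))
          refine ⟨f, ?_, ?_⟩
          · convert hf using 3
            ext j
            by_cases hj : j = n <;> simp [hj, hns]
          · have : insert n F \ s = F \ s.erase n := by
              ext j
              by_cases hj : j = n
              · subst hj; simp [hns, hnF]
              · simp [hj]
            rw [this]
            refine hsum.trans ?_
            rw [hpow]
            nlinarith
        · obtain ⟨f, hf, hsum, hfn⟩ := h₂ s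
            (Finset.mem_powerset.2 ((Finset.subset_insert_iff_of_notMem hns).1 hs)) L hL hLinf
          refine ⟨f, hf, ?_⟩
          rw [Finset.insert_sdiff_of_notMem _ hns, Finset.sum_insert (by simp [hnF])]
          rw [hε', hpow] at hfn
          rw [hpow]
          linarith
      · exfalso
        -- The bound `J` is uniform in the functional, so the infinite part can be fixed beyond `J`
        -- first; the functional it provides is small at some `n ≤ J` in `M`, against `h`.
        obtain ⟨J, hJ⟩ := exists_forall_exists_abs_le hx hMinf hε'0
        have hLinf := infinite_sep_gt hMinf J
        obtain ⟨f, hf, hsum⟩ := hF s (Finset.mem_powerset.1 hs) {j ∈ M | J < j}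
          (fun j hj => hM hj.1) hLinf
        obtain ⟨n, hnM, hnJ, hfn⟩ := hJ f (hG _ f hf)
        exact h n hnM {j ∈ M | J < j} (fun j hj => ⟨hj.1, hnJ.trans_lt hj.2⟩) hLinf
          ⟨f, hf, hsum, hfn⟩)
  refine ⟨Set.range n, Set.infinite_range_of_injective hn.injective, fun L hL hLinf => ?_⟩
  classical
  set m := frontIndex G L with hm
  set F := (Finset.range (m + 1)).image n with hFdef
  have hmemF : ∀ j ≤ m, j ∈ Set.range n → j ∈ F := by
    rintro _ hj ⟨k, rfl⟩
    exact Finset.mem_image_of_mem _ (Finset.mem_range.2 (by have := hn.id_le k; simp at this; omega))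
  -- Replacing the tail of `L` by the reservoir does not change the front segment, because `F`
  -- contains all elements of `L` up to `m` and the reservoir lies beyond `m`.
  obtain ⟨f, hf, hsum⟩ := hP (m + 1) (F.filter (· ∈ L)) (Finset.filter_subset _ _) (R (m + 1))
    subset_rfl (hRinf _)
  rw [frontSeg_congr (hfront L hLinf) (fun j hj => ?_)] at hf
  · refine ⟨frontSeg G L, fun j hj => (mem_segUpTo.1 hj).2, f, hf, fun T hT hdisj hle => ?_⟩
    calc ∑ i ∈ T, |f (x i)| ≤ ∑ i ∈ F \ F.filter (· ∈ L), |f (x i)| := by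
          refine Finset.sum_le_sum_of_subset_of_nonneg (fun i hi => ?_) fun _ _ _ => abs_nonneg _
          obtain ⟨j, hj, hij⟩ := hle i hi
          have him : i ≤ m := hij.trans (mem_segUpTo.1 hj).1
          refine Finset.mem_sdiff.2 ⟨hmemF i him (hT hi), fun hiL => ?_⟩
          exact Finset.disjoint_left.1 hdisj hi
            (mem_segUpTo.2 ⟨him, (Finset.mem_filter.1 hiL).2⟩)
      _ ≤ ε * (1 - (1 / 2) ^ F.card) := hsum
      _ ≤ ε := by
          have : (0 : ℝ) < (1 / 2) ^ F.card := by positivity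
          nlinarith
  · constructor
    · rintro (h | h)
      · exact (Finset.mem_filter.1 h).2
      · have h1 := hlt m j h
        have h2 := hn.id_le m
        simp only [id] at h2
        omega
    · exact fun h => Or.inl (Finset.mem_filter.2 ⟨hmemF j hj (hL h), h⟩)

end

/-! ### Construction of the dual sequence -/

/-- The coordinates on a pointwise bounded family of sequences, whose pointwise limits tend to zero,
form a weakly null sequence for the supremum norm over the family. -/
theorem exists_weaklyNull_of_family {A : Set (ℕ → ℝ)} {C : ℝ≥0} (hC : ∀ κ ∈ A, ∀ i, |κ i| ≤ C)
    (hlim : ∀ κ ∈ closure A, Tendsto κ atTop (𝓝 0)) :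
    ∃ (Y : Type u) (_ : NormedAddCommGroup Y) (_ : NormedSpace ℝ Y) (_ : CompleteSpace Y)
      (y : ℕ → Y), (∀ φ : Y →L[ℝ] ℝ, Tendsto (fun n => φ (y n)) atTop (𝓝 0)) ∧
      ∀ (s : Finset ℕ) (c : ℕ → ℝ) (r : ℝ), 0 ≤ r →
        (‖∑ i ∈ s, c i • y i‖ ≤ r ↔ ∀ κ ∈ A, |∑ i ∈ s, c i * κ i| ≤ r) := by
  have hclosed : IsClosed {κ : ℕ → ℝ | ∀ i, |κ i| ≤ C} := by
    simp only [Set.ofPred_forall]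
    exact isClosed_iInter fun i => isClosed_le (continuous_apply i).abs continuous_const
  have hsub : closure A ⊆ {κ : ℕ → ℝ | ∀ i, |κ i| ≤ C} := closure_minimal hC hclosed
  have hcomp : IsCompact (closure A) := by
    refine (isCompact_univ_pi fun _ : ℕ => isCompact_Icc (a := -(C : ℝ)) (b := C)).of_isClosed_subset
      isClosed_closure fun κ hκ i _ => abs_le.1 (hsub hκ i)
  have : CompactSpace (closure A) := isCompact_iff_compactSpace.1 hcomp
  -- The lift places the space in universe `u`, over which the suprema in the constants range.
  let y : ℕ → C(ULift.{u} (closure A), ℝ) := fun i =>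
    ⟨fun κ => κ.down.1 i, (continuous_apply i).comp (continuous_subtype_val.comp continuous_uliftDown)⟩
  refine ⟨C(ULift.{u} (closure A), ℝ), inferInstance, inferInstance, inferInstance, y, ?_, ?_⟩
  · exact tendsto_functional_of_tendsto_apply (C := C) (fun n κ => hsub κ.down.2 n)
      fun κ => hlim κ.down.1 κ.down.2
  · intro s c r hr
    have happ : ∀ κ, (∑ i ∈ s, c i • y i) κ = ∑ i ∈ s, c i * κ.down.1 i := fun κ => by
      rw [ContinuousMap.coe_sum, Finset.sum_apply]
      rfl
    rw [ContinuousMap.norm_le _ hr]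
    simp only [happ, Real.norm_eq_abs]
    constructor
    · exact fun h κ hκ => h ⟨⟨κ, subset_closure hκ⟩⟩
    · intro h κ
      have hcl : IsClosed {κ : ℕ → ℝ | |∑ i ∈ s, c i * κ i| ≤ r} :=
        isClosed_le (by fun_prop) continuous_const
      exact closure_minimal (s := A) h hcl κ.down.2

variable {X : Type u} [NormedAddCommGroup X] [NormedSpace ℝ X]

/-- From pairs `(a, f)`, of a vector and a functional, which occur inside each infinite set, one
can select a family indexed by an antichain of finite sets such that the restrictions of the
functionals to their index sets are almost in the polar of the vectors. -/
theorem exists_antichain_family {x : ℕ → X} (hx : NormalizedWeaklyNull x) {η : ℝ} (hη : 0 < η)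
    (hcoord : CoordBound x (1 + η)) (htrunc : TruncBound x (1 + η))
    {W : (ℕ →₀ ℝ) → (X →L[ℝ] ℝ) → Prop}
    (hW : ∀ a f, W a f → ‖f‖ ≤ 1 ∧ ‖a.sum fun i c => c • x i‖ ≤ 1)
    (hne : ∀ L : Set ℕ, L.Infinite → ∃ a f, ↑a.support ⊆ L ∧ W a f) :
    ∃ (N : Set ℕ) (B : Set (Finset ℕ)) (a : Finset ℕ → ℕ →₀ ℝ) (f : Finset ℕ → X →L[ℝ] ℝ),
      N.Infinite ∧ (∀ s ∈ B, ↑s ⊆ N ∧ (a s).support ⊆ s ∧ W (a s) (f s)) ∧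
      (∀ s ∈ B, ∀ t ∈ B, t ⊆ s → t = s) ∧ (∀ L ⊆ N, L.Infinite → ∃ s ∈ B, ↑s ⊆ L) ∧
      ∀ s ∈ B, ∀ t ∈ B, |∑ i ∈ s, f s (x i) * a t i| ≤ (1 + η) ^ 2 := by
  obtain ⟨N, hN, hsel⟩ := exists_infinite_forall_subset_sum_le hx
    (G := fun s => {f | ∃ a : ℕ →₀ ℝ, a.support ⊆ s ∧ W a f})
    (fun s f ⟨a, _, h⟩ => (hW a f h).1)
    (fun s t hst f ⟨a, ha, h⟩ => ⟨a, ha.trans hst, h⟩)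
    (fun L hL => by
      obtain ⟨a, f, ha, h⟩ := hne L hL
      exact ⟨a.support, ha, f, a, subset_rfl, h⟩) hη
  let good : Finset ℕ → Prop := fun s => ↑s ⊆ N ∧ ∃ (f : X →L[ℝ] ℝ) (a : ℕ →₀ ℝ),
    (a.support ⊆ s ∧ W a f) ∧ ∀ T : Finset ℕ, ↑T ⊆ N → Disjoint T s →
      (∀ i ∈ T, ∃ j ∈ s, i ≤ j) → ∑ i ∈ T, |f (x i)| ≤ η
  have hch : ∀ s, ∃ (f : X →L[ℝ] ℝ) (a : ℕ →₀ ℝ), good s → (a.support ⊆ s ∧ W a f) ∧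
      ∀ T : Finset ℕ, ↑T ⊆ N → Disjoint T s →
      (∀ i ∈ T, ∃ j ∈ s, i ≤ j) → ∑ i ∈ T, |f (x i)| ≤ η := fun s => by
    by_cases hs : good s
    · obtain ⟨f, a, h⟩ := hs.2
      exact ⟨f, a, fun _ => h⟩
    · exact ⟨0, 0, fun h => absurd h hs⟩
  choose f a hfa using hch
  refine ⟨N, {s | Minimal good s}, a, f, hN, fun s hs => ⟨hs.prop.1, (hfa s hs.prop).1⟩,
    fun s hs t ht hts => hs.eq_of_le ht.prop hts, fun L hL hLinf => ?_, fun s hs t ht => ?_⟩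
  · obtain ⟨s, hsL, f, ⟨a, ha⟩, hT⟩ := hsel L hL hLinf
    obtain ⟨t, hts, ht⟩ := exists_minimal_le_of_wellFoundedLT good s ⟨hsL.trans hL, f, a, ha, hT⟩
    exact ⟨t, ht, (Finset.coe_subset.2 hts).trans hsL⟩
  · obtain ⟨⟨-, hWs⟩, hTs⟩ := hfa s hs.prop
    obtain ⟨⟨hat, hWt⟩, -⟩ := hfa t ht.prop
    rcases s.eq_empty_or_nonempty with rfl | hsne
    · simp only [Finset.sum_empty, abs_zero]
      positivity
    obtain ⟨m, hm, hmax⟩ := s.exists_max_image id hsne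
    -- The functional of `s` is tested on the vector of `t` truncated at m = max s. Removing the
    -- indices of `t` outside `s` costs at most (1+η)η, for a total of (1+η) + (1+η)η = (1+η)².
    have h1 : |∑ i ∈ Finset.range (m + 1), f s (x i) * a t i| ≤ 1 + η := by
      have h := (f s).le_of_opNorm_le (hW _ _ hWs).1
        (∑ i ∈ Finset.range (m + 1), a t i • x i)
      rw [map_sum, one_mul, Real.norm_eq_abs] at h
      simp only [map_smul, smul_eq_mul, mul_comm (a t _)] at h
      refine h.trans ((htrunc (a t) (m + 1)).trans ?_)
      exact mul_le_of_le_one_right (by positivity) (hW _ _ hWt).2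
    have h2 : |∑ i ∈ (Finset.range (m + 1) ∩ t) \ s, f s (x i) * a t i| ≤ (1 + η) * η := by
      calc |∑ i ∈ (Finset.range (m + 1) ∩ t) \ s, f s (x i) * a t i|
          ≤ ∑ i ∈ (Finset.range (m + 1) ∩ t) \ s, |f s (x i) * a t i| :=
            Finset.abs_sum_le_sum_abs _ _
        _ ≤ ∑ i ∈ (Finset.range (m + 1) ∩ t) \ s, (1 + η) * |f s (x i)| := by
            refine Finset.sum_le_sum fun i _ => ?_
            rw [abs_mul, mul_comm]
            refine mul_le_mul_of_nonneg_right ?_ (abs_nonneg _)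
            exact (hcoord (a t) i).trans
              (mul_le_of_le_one_right (by positivity) (hW _ _ hWt).2)
        _ ≤ (1 + η) * η := by
            rw [← Finset.mul_sum]
            refine mul_le_mul_of_nonneg_left (hTs _ (fun i hi => ?_) Finset.sdiff_disjoint
              fun i hi => ⟨m, hm, ?_⟩) (by positivity)
            · exact ht.prop.1 (Finset.mem_inter.1 (Finset.mem_sdiff.1 hi).1).2
            · have := Finset.mem_range.1 (Finset.mem_inter.1 (Finset.mem_sdiff.1 hi).1).1
              omega
    have h3 : ∑ i ∈ Finset.range (m + 1), f s (x i) * a t i =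
        ∑ i ∈ s, f s (x i) * a t i + ∑ i ∈ (Finset.range (m + 1) ∩ t) \ s, f s (x i) * a t i := by
      have hsr : s ⊆ Finset.range (m + 1) := fun i hi =>
        Finset.mem_range.2 (Nat.lt_succ_of_le (hmax i hi))
      rw [← Finset.sum_sdiff hsr, add_comm]
      congr 1
      symm
      refine Finset.sum_subset (Finset.sdiff_subset_sdiff Finset.inter_subset_left subset_rfl)
        fun i hi hi' => ?_
      have : a t i = 0 := by
        by_contra h
        have hit := hat (Finsupp.mem_support_iff.2 h)
        simp only [Finset.mem_sdiff, Finset.mem_inter] at hi hi'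
        exact hi' ⟨⟨hi.1, hit⟩, hi.2⟩
      rw [this, mul_zero]
    have h4 : ∑ i ∈ s, f s (x i) * a t i = ∑ i ∈ Finset.range (m + 1), f s (x i) * a t i -
        ∑ i ∈ (Finset.range (m + 1) ∩ t) \ s, f s (x i) * a t i := by rw [h3]; ring
    rw [h4]
    refine (abs_sub _ _).trans ?_
    nlinarith

/-- Functions supported on the members of an antichain of finite sets which meets all infinite
subsets of `N` have, together with the unit vectors, only finitely supported pointwise limits. -/
theorem finite_support_of_mem_closure {N : Set ℕ} {B : Set (Finset ℕ)} {a : Finset ℕ → ℕ →₀ ℝ}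
    (hB : ∀ s ∈ B, ↑s ⊆ N ∧ (a s).support ⊆ s) (hanti : ∀ s ∈ B, ∀ t ∈ B, t ⊆ s → t = s)
    (hinf : ∀ L ⊆ N, L.Infinite → ∃ s ∈ B, ↑s ⊆ L) {κ : ℕ → ℝ}
    (hκ : κ ∈ closure ((fun s => ⇑(a s)) '' B ∪ Set.range fun n => (Pi.single n 1 : ℕ → ℝ))) :
    {i | κ i ≠ 0}.Finite := by
  by_contra hL
  have hLinf : {i | κ i ≠ 0}.Infinite := hL
  obtain ⟨i₀, hi₀⟩ := hLinf.nonempty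
  obtain ⟨j₀, hj₀, hij⟩ := hLinf.exists_gt i₀
  -- The two points `i₀` and `j₀` rule out unit vectors as approximants. If the support were
  -- infinite it would contain some `t ∈ B`, and a member of `B` containing `t` and one further
  -- point would contradict the antichain property.
  have key : ∀ F : Finset ℕ, (∀ i ∈ F, κ i ≠ 0) → ∃ s ∈ B, F ⊆ s := by
    intro F hF
    have hopen : IsOpen (⋂ i ∈ insert i₀ (insert j₀ F), {κ' : ℕ → ℝ | κ' i ≠ 0}) :=
      isOpen_biInter_finset fun i _ => isOpen_ne_fun (continuous_apply i) continuous_const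
    obtain ⟨κ', hκ', hA⟩ := mem_closure_iff.1 hκ _ hopen (Set.mem_iInter₂.2 fun i hi => by
      simp only [Finset.mem_insert] at hi
      rcases hi with rfl | rfl | hi
      exacts [hi₀, hj₀, hF i hi])
    have hne : ∀ i ∈ insert i₀ (insert j₀ F), κ' i ≠ 0 := fun i hi => Set.mem_iInter₂.1 hκ' i hi
    rcases hA with ⟨s, hs, rfl⟩ | ⟨n, rfl⟩
    · exact ⟨s, hs, fun i hi => (hB s hs).2 (Finsupp.mem_support_iff.2 (hne i (by simp [hi])))⟩
    · exfalso
      have h1 : i₀ = n := by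
        by_contra h
        exact hne i₀ (by simp) (Pi.single_eq_of_ne h 1)
      have h2 : j₀ = n := by
        by_contra h
        exact hne j₀ (by simp) (Pi.single_eq_of_ne h 1)
      omega
  obtain ⟨t, htB, ht⟩ := hinf _ (fun i hi => by
    obtain ⟨s, hs, his⟩ := key {i} (by simpa using hi)
    exact (hB s hs).1 (his (Finset.mem_singleton_self i))) hLinf
  obtain ⟨i, hi, hit⟩ := hLinf.exists_notMem_finset t
  obtain ⟨s, hs, hts⟩ := key (insert i t) (fun j hj => by
    rcases Finset.mem_insert.1 hj with rfl | hj
    exacts [hi, ht hj])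
  have := hanti s hs t htB ((Finset.subset_insert _ _).trans hts)
  exact hit (this ▸ hts (Finset.mem_insert_self _ _))

/-- Pairs `(a, f)` of vectors and functionals which occur inside each infinite set give rise to a
normalized weakly null sequence on which the functionals act as vectors and the vectors as
functionals. -/
theorem exists_dual_sequence {x : ℕ → X} (hx : NormalizedWeaklyNull x) {η : ℝ} (hη : 0 < η)
    (hcoord : CoordBound x (1 + η)) (htrunc : TruncBound x (1 + η))
    {W : (ℕ →₀ ℝ) → (X →L[ℝ] ℝ) → Prop}
    (hW : ∀ a f, W a f → ‖f‖ ≤ 1 ∧ ‖a.sum fun i c => c • x i‖ ≤ 1)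
    (hne : ∀ L : Set ℕ, L.Infinite → ∃ a f, ↑a.support ⊆ L ∧ W a f) :
    ∃ (Y : Type u) (_ : NormedAddCommGroup Y) (_ : NormedSpace ℝ Y) (_ : CompleteSpace Y)
      (z : ℕ → Y) (n : ℕ → ℕ) (w : ℕ → ℝ), NormalizedWeaklyNull z ∧ StrictMono n ∧
      (∀ k, 1 ≤ w k ∧ w k ≤ 1 + η) ∧ ∀ φ : ℕ → ℕ, StrictMono φ →
        ∃ (a : ℕ →₀ ℝ) (f : X →L[ℝ] ℝ) (s : Finset ℕ), W a f ∧
          a.support ⊆ s.image (n ∘ φ) ∧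
          ‖∑ k ∈ s, (f (x (n (φ k))) * w (φ k)) • z (φ k)‖ ≤ (1 + η) ^ 2 ∧
          ∀ E ⊆ s, ∑ k ∈ E, f (x (n (φ k))) * a (n (φ k)) ≤
            ‖∑ k ∈ E, (f (x (n (φ k))) * w (φ k)) • z (φ k)‖ := by
  obtain ⟨N, B, a, f, hN, hB, hanti, hBinf, hpolar⟩ :=
    exists_antichain_family hx hη hcoord htrunc hW hne
  -- The unit vectors ensure 1 ≤ ‖yᵢ‖, so normalizing preserves weak nullness and changes
  -- coefficients by a factor `w k` of at most 1 + η.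
  set A : Set (ℕ → ℝ) := (fun s => ⇑(a s)) '' B ∪ Set.range fun n => (Pi.single n 1 : ℕ → ℝ) with hA
  have hAbd : ∀ κ ∈ A, ∀ i, |κ i| ≤ 1 + η := by
    rintro _ (⟨s, hs, rfl⟩ | ⟨n, rfl⟩) i
    · exact (hcoord (a s) i).trans
        (mul_le_of_le_one_right (by positivity) (hW _ _ (hB s hs).2.2).2)
    · by_cases h : i = n
      · subst h; simp [hη.le]
      · simp only [Pi.single_eq_of_ne h, abs_zero]; positivity
  obtain ⟨Y, _, _, _, y, hy0, hynorm⟩ := exists_weaklyNull_of_family.{u} (A := A)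
    (C := ⟨1 + η, by positivity⟩) hAbd (fun κ hκ => by
      have hfin := finite_support_of_mem_closure (fun s hs => ⟨(hB s hs).1, (hB s hs).2.1⟩)
        hanti hBinf hκ
      refine tendsto_const_nhds.congr' ?_
      rw [← Nat.cofinite_eq_atTop]
      filter_upwards [hfin.compl_mem_cofinite] with i hi
      exact (not_not.1 hi).symm)
  have hylow : ∀ (E : Finset ℕ) (c : ℕ → ℝ), ∀ κ ∈ A, ∑ i ∈ E, c i * κ i ≤ ‖∑ i ∈ E, c i • y i‖ :=
    fun E c κ hκ => (le_abs_self _).trans ((hynorm E c _ (norm_nonneg _)).1 le_rfl κ hκ)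
  have hy1 : ∀ i, 1 ≤ ‖y i‖ := fun i => by
    simpa using hylow {i} 1 (Pi.single i 1) (Or.inr ⟨i, rfl⟩)
  have hy2 : ∀ i, ‖y i‖ ≤ 1 + η := fun i => by
    simpa using (hynorm {i} 1 (1 + η) (by positivity)).2 fun κ hκ => by simpa using hAbd κ hκ i
  have hypos : ∀ i, 0 < ‖y i‖ := fun i => one_pos.trans_le (hy1 i)
  let n : ℕ → ℕ := Nat.nth (· ∈ N)
  have hn : StrictMono n := Nat.nth_strictMono hN
  have hnrange : ∀ k, n k ∈ N := Nat.nth_mem_of_infinite hN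
  refine ⟨Y, inferInstance, inferInstance, inferInstance, fun k => ‖y (n k)‖⁻¹ • y (n k), n,
    fun k => ‖y (n k)‖, ⟨fun k => ?_, fun g => ?_⟩, hn, fun k => ⟨hy1 _, hy2 _⟩, fun φ hφ => ?_⟩
  · rw [norm_smul, norm_inv, norm_norm, inv_mul_cancel₀ (hypos _).ne']
  · have h0 := ((hy0 g).comp hn.tendsto_atTop).norm
    rw [norm_zero] at h0
    refine squeeze_zero_norm (fun k => ?_) h0
    rw [map_smul, norm_smul, norm_inv, norm_norm]
    exact mul_le_of_le_one_left (norm_nonneg _) (inv_le_one_of_one_le₀ (hy1 _))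
  have hinj : Function.Injective (n ∘ φ) := (hn.comp hφ).injective
  -- A member of `B` lies inside every subsequence, so passing to subsequences of the dual sequence
  -- cannot remove the bad vectors.
  obtain ⟨s, hs, hsr⟩ := hBinf (Set.range (n ∘ φ)) (by rintro _ ⟨k, rfl⟩; exact hnrange _)
    (Set.infinite_range_of_injective hinj)
  obtain ⟨s', rfl⟩ : ∃ s' : Finset ℕ, s'.image (n ∘ φ) = s := by
    refine ⟨s.preimage (n ∘ φ) hinj.injOn, ?_⟩
    classical
    rw [Finset.image_preimage]
    exact Finset.filter_true_of_mem fun i hi => hsr hi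
  set s := s'.image (n ∘ φ) with hsdef
  have hsum : ∀ E : Finset ℕ, ∑ k ∈ E, (f s (x (n (φ k))) * ‖y (n (φ k))‖) •
      (‖y (n (φ k))‖⁻¹ • y (n (φ k))) = ∑ i ∈ E.image (n ∘ φ), f s (x i) • y i := fun E => by
    rw [Finset.sum_image hinj.injOn]
    refine Finset.sum_congr rfl fun k _ => ?_
    rw [smul_smul, mul_assoc, mul_inv_cancel₀ (hypos _).ne', mul_one]
    rfl
  refine ⟨a s, f s, s', (hB s hs).2.2, (hB s hs).2.1, ?_, fun E _ => ?_⟩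
  · rw [hsum]
    refine (hynorm _ _ _ (by positivity)).2 ?_
    rintro _ (⟨t, ht, rfl⟩ | ⟨j, rfl⟩)
    · exact hpolar s hs t ht
    · have hle : |f s (x j)| ≤ 1 := by
        have := (f s).le_of_opNorm_le (hW _ _ (hB s hs).2.2).1 (x j)
        simpa [hx.1] using this
      have h1 : 1 ≤ (1 + η) ^ 2 := by nlinarith
      simp only [Pi.single_apply, mul_ite, mul_one, mul_zero, Finset.sum_ite_eq']
      split_ifs
      · exact hle.trans h1
      · simp only [abs_zero]; positivity
  · rw [hsum]
    refine le_trans (le_of_eq ?_) (hylow (E.image (n ∘ φ)) (fun i => f s (x i)) (a s)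
      (Or.inl ⟨s, hs, rfl⟩))
    rw [Finset.sum_image hinj.injOn]
    rfl

/-! ### Extracting witnesses from the constants -/

theorem exists_finsupp_eq_on (c : ℕ → ℝ) (s : Finset ℕ) :
    ∃ a : ℕ →₀ ℝ, (∀ i ∈ s, a i = c i) ∧
      ∀ x : ℕ → X, (a.sum fun i r => r • x i) = ∑ i ∈ s, c i • x i := by
  refine ⟨Finsupp.indicator s fun i _ => c i, fun i hi => Finsupp.indicator_of_mem hi _,
    fun x => ?_⟩
  rw [Finsupp.sum_of_support_subset _ (Finsupp.support_indicator_subset _ _) _ (by simp)]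
  exact Finset.sum_congr rfl fun i hi => by rw [Finsupp.indicator_of_mem hi]

theorem exists_subsequence_of_nearConst_lt {δ : ℝ} {C : ℝ≥0} (h : nearConst.{u} δ < C)
    [CompleteSpace X] {z : ℕ → X} (hz : NormalizedWeaklyNull z) :
    ∃ φ : ℕ → ℕ, StrictMono φ ∧ ∀ (c : ℕ → ℝ) (s : Finset ℕ), ∀ E ⊆ s, (∀ i ∈ E, δ ≤ |c i|) →
      ‖∑ i ∈ s, c i • z (φ i)‖ ≤ 1 →
      ‖∑ i ∈ E, c i • z (φ i)‖ ≤ C * ‖∑ i ∈ s, c i • z (φ i)‖ := by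
  have h1 : (⨅ (φ : ℕ → ℕ) (_ : StrictMono φ), nearConstOf (z ∘ φ) δ) < C := by
    refine lt_of_le_of_lt ?_ h
    exact le_iSup_of_le X <| le_iSup_of_le _ <| le_iSup_of_le _ <|
      le_iSup_of_le ‹CompleteSpace X› <|
      le_iSup_of_le z <| le_iSup_of_le hz le_rfl
  simp only [iInf_lt_iff, nearConstOf] at h1
  obtain ⟨φ, hφ, C', hC', hlt⟩ := h1
  refine ⟨φ, hφ, fun c s E hE hδ hs => ?_⟩
  obtain ⟨a, ha, hsum⟩ := exists_finsupp_eq_on (X := X) c s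
  have := hC' a E (fun i hi => by rw [ha i (hE hi)]; exact hδ i hi) (by rw [hsum]; exact hs)
  rw [hsum, Finset.sum_congr rfl fun i hi => by rw [ha i (hE hi)]] at this
  refine this.trans (mul_le_mul_of_nonneg_right ?_ (norm_nonneg _))
  exact_mod_cast hlt.le

theorem exists_subsequence_of_convexConst_lt {δ : ℝ} {C : ℝ≥0} (h : convexConst.{u} δ < C)
    [CompleteSpace X] {z : ℕ → X} (hz : NormalizedWeaklyNull z) :
    ∃ φ : ℕ → ℕ, StrictMono φ ∧ ∀ (c : ℕ → ℝ) (s : Finset ℕ), ∀ E ⊆ s,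
      δ * ∑ i ∈ E, |c i| ≤ ‖∑ i ∈ E, c i • z (φ i)‖ →
      ‖∑ i ∈ E, c i • z (φ i)‖ ≤ C * ‖∑ i ∈ s, c i • z (φ i)‖ := by
  have h1 : (⨅ (φ : ℕ → ℕ) (_ : StrictMono φ), convexConstOf (z ∘ φ) δ) < C := by
    refine lt_of_le_of_lt ?_ h
    exact le_iSup_of_le X <| le_iSup_of_le _ <| le_iSup_of_le _ <|
      le_iSup_of_le ‹CompleteSpace X› <|
      le_iSup_of_le z <| le_iSup_of_le hz le_rfl
  simp only [iInf_lt_iff, convexConstOf] at h1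
  obtain ⟨φ, hφ, C', hC', hlt⟩ := h1
  refine ⟨φ, hφ, fun c s E hE hδ => ?_⟩
  obtain ⟨a, ha, hsum⟩ := exists_finsupp_eq_on (X := X) c s
  have hEa : ∀ x : ℕ → X, ∑ i ∈ E, a i • x i = ∑ i ∈ E, c i • x i := fun x =>
    Finset.sum_congr rfl fun i hi => by rw [ha i (hE hi)]
  have := hC'.2 a E (by
    rw [hEa, Finset.sum_congr rfl fun i hi => by rw [ha i (hE hi)]]
    exact hδ)
  rw [hsum, hEa] at this
  refine this.trans (mul_le_mul_of_nonneg_right ?_ (norm_nonneg _))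
  exact_mod_cast hlt.le

theorem exists_strictMono_forall_mem {L : Set ℕ} (hL : L.Infinite) :
    ∃ φ : ℕ → ℕ, StrictMono φ ∧ ∀ k, φ k ∈ L :=
  ⟨Nat.nth (· ∈ L), Nat.nth_strictMono hL, Nat.nth_mem_of_infinite hL⟩

/-- A finite linear combination of a subsequence, normalized and seen in the whole sequence. -/
theorem exists_normalized_of_comp {x : ℕ → X} {C : ℝ} (hx : CoordBound x C) {φ : ℕ → ℕ}
    (hφ : StrictMono φ) {b : ℕ →₀ ℝ} {E : Finset ℕ} {Λ : ℝ} (hΛ : 0 ≤ Λ)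
    (hb : Λ * ‖b.sum fun i c => c • (x ∘ φ) i‖ < ‖∑ i ∈ E, b i • (x ∘ φ) i‖) :
    ∃ (r : ℝ) (a : ℕ →₀ ℝ) (F : Finset ℕ), 0 < r ∧ r * ‖b.sum fun i c => c • (x ∘ φ) i‖ = 1 ∧
      (∀ i ∈ a.support, i ∈ Set.range φ) ∧ F ⊆ a.support ∧ ‖a.sum fun i c => c • x i‖ = 1 ∧
      ‖∑ i ∈ F, a i • x i‖ = r * ‖∑ i ∈ E, b i • (x ∘ φ) i‖ ∧
      ∑ i ∈ F, |a i| = r * ∑ i ∈ E, |b i| ∧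
      (∀ i ∈ F, ∃ k ∈ E, a i = r * b k) ∧ Λ < ‖∑ i ∈ F, a i • x i‖ := by
  classical
  set S := ‖b.sum fun i c => c • (x ∘ φ) i‖ with hS
  have hS0 : 0 < S := by
    refine (norm_nonneg _).lt_of_ne fun h0 => ?_
    have hb0 : ∀ i, b i = 0 := fun i => by
      have := hx.comp hφ b i
      rw [← h0, mul_zero] at this
      exact abs_nonpos_iff.1 this
    have : (0 : ℝ) < ‖∑ i ∈ E, b i • (x ∘ φ) i‖ := lt_of_le_of_lt (by positivity) hb
    simp [hb0] at this
  set a : ℕ →₀ ℝ := S⁻¹ • b.mapDomain φ with ha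
  have haφ : ∀ k, a (φ k) = S⁻¹ * b k := fun k => by
    rw [ha, Finsupp.smul_apply, Finsupp.mapDomain_apply hφ.injective, smul_eq_mul]
  have hasum : (a.sum fun i c => c • x i) = S⁻¹ • b.sum fun i c => c • (x ∘ φ) i := by
    rw [ha, Finsupp.sum_smul_index (by simp), Finsupp.sum_mapDomain_index_inj hφ.injective,
      Finsupp.smul_sum]
    simp only [mul_smul, Function.comp]
  have hEsum : ∀ {M : Type u} [AddCommGroup M] [Module ℝ M] (g : ℕ → M),
      ∑ i ∈ (E ∩ b.support).image φ, a i • g i = S⁻¹ • ∑ k ∈ E, b k • g (φ k) := by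
    intro M _ _ g
    rw [Finset.sum_image hφ.injective.injOn, Finset.smul_sum]
    refine (Finset.sum_subset Finset.inter_subset_left fun k hk hk' => ?_).trans
      (Finset.sum_congr rfl fun k _ => by rw [haφ, mul_smul])
    have : b k = 0 := by
      by_contra h
      exact hk' (Finset.mem_inter.2 ⟨hk, Finsupp.mem_support_iff.2 h⟩)
    rw [haφ, this, mul_zero, zero_smul]
  have hnorm : ‖∑ i ∈ (E ∩ b.support).image φ, a i • x i‖ = S⁻¹ * ‖∑ i ∈ E, b i • (x ∘ φ) i‖ := by
    rw [hEsum, norm_smul, norm_inv, Real.norm_of_nonneg hS0.le]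
    rfl
  refine ⟨S⁻¹, a, (E ∩ b.support).image φ, inv_pos.2 hS0, inv_mul_cancel₀ hS0.ne', ?_, ?_, ?_,
    hnorm, ?_, ?_, ?_⟩
  · intro i hi
    by_contra h
    rw [Finsupp.mem_support_iff, ha, Finsupp.smul_apply,
      Finsupp.mapDomain_of_notMem_range _ _ h, smul_zero] at hi
    exact hi rfl
  · intro i hi
    obtain ⟨k, hk, rfl⟩ := Finset.mem_image.1 hi
    rw [Finsupp.mem_support_iff, haφ]
    exact mul_ne_zero (inv_ne_zero hS0.ne')
      (Finsupp.mem_support_iff.1 (Finset.mem_inter.1 hk).2)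
  · rw [hasum, norm_smul, norm_inv, Real.norm_of_nonneg hS0.le, ← hS, inv_mul_cancel₀ hS0.ne']
  · rw [Finset.sum_image hφ.injective.injOn, Finset.mul_sum]
    refine (Finset.sum_subset Finset.inter_subset_left fun k hk hk' => ?_).trans
      (Finset.sum_congr rfl fun k _ => by rw [haφ, abs_mul, abs_inv, abs_of_pos hS0])
    have : b k = 0 := by
      by_contra h
      exact hk' (Finset.mem_inter.2 ⟨hk, Finsupp.mem_support_iff.2 h⟩)
    rw [haφ, this, mul_zero, abs_zero]
  · intro i hi
    obtain ⟨k, hk, rfl⟩ := Finset.mem_image.1 hi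
    exact ⟨k, (Finset.mem_inter.1 hk).1, haφ k⟩
  · rw [hnorm, lt_inv_mul_iff₀ hS0, mul_comm]
    exact hb

theorem exists_of_lt_nearConstOf {x : ℕ → X} {C δ : ℝ} (hC : CoordBound x C) (hδ : 0 < δ)
    {Λ : ℝ≥0} (h : ∀ φ, StrictMono φ → Λ < nearConstOf (x ∘ φ) δ) {L : Set ℕ}
    (hL : L.Infinite) : ∃ (a : ℕ →₀ ℝ) (E : Finset ℕ), ↑a.support ⊆ L ∧ E ⊆ a.support ∧
      ‖a.sum fun i c => c • x i‖ = 1 ∧ (∀ i ∈ E, δ ≤ |a i|) ∧ Λ < ‖∑ i ∈ E, a i • x i‖ := by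
  obtain ⟨φ, hφ, hφL⟩ := exists_strictMono_forall_mem hL
  have h1 := h φ hφ
  rw [← not_le] at h1
  obtain ⟨b, E, hδE, hb1, hb⟩ : ∃ (b : ℕ →₀ ℝ) (E : Finset ℕ), (∀ i ∈ E, δ ≤ |b i|) ∧
      ‖b.sum fun i c => c • (x ∘ φ) i‖ ≤ 1 ∧
      Λ * ‖b.sum fun i c => c • (x ∘ φ) i‖ < ‖∑ i ∈ E, b i • (x ∘ φ) i‖ := by
    by_contra! hcon
    exact h1 (iInf₂_le Λ hcon)
  obtain ⟨r, a, F, hr, hr1, ha, hF, hnorm, -, -, hFE, hlt⟩ :=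
    exists_normalized_of_comp hC hφ Λ.2 hb
  refine ⟨a, F, fun i hi => ?_, hF, hnorm, fun i hi => ?_, hlt⟩
  · obtain ⟨k, rfl⟩ := ha i hi
    exact hφL k
  · obtain ⟨k, hk, hak⟩ := hFE i hi
    rw [hak, abs_mul, abs_of_pos hr]
    -- The norm before scaling is at most 1, so normalizing can only enlarge the coefficients.
    have h2 : 1 ≤ r := by nlinarith
    nlinarith [hδE k hk]

theorem exists_of_lt_convexConstOf {x : ℕ → X} {C C' δ : ℝ} (hx : NormalizedWeaklyNull x)
    (hC : CoordBound x C) (hC' : TruncBound x C')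
    {Λ : ℝ≥0} (h : ∀ φ, StrictMono φ → Λ < convexConstOf (x ∘ φ) δ) {L : Set ℕ}
    (hL : L.Infinite) : ∃ (a : ℕ →₀ ℝ) (E : Finset ℕ), ↑a.support ⊆ L ∧ E ⊆ a.support ∧
      ‖a.sum fun i c => c • x i‖ = 1 ∧ δ * ∑ i ∈ E, |a i| ≤ ‖∑ i ∈ E, a i • x i‖ ∧
      Λ < ‖∑ i ∈ E, a i • x i‖ := by
  obtain ⟨φ, hφ, hφL⟩ := exists_strictMono_forall_mem hL
  have h1 := h φ hφ
  rw [← not_le] at h1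
  -- Being basic is part of convex-unconditionality; once it is secured, a large constant can only
  -- come from a violated inequality.
  have hbasic : IsBasicSequence (x ∘ φ) :=
    ⟨fun n h0 => by
      have := (hx.comp hφ).1 n
      rw [h0, norm_zero] at this
      exact zero_ne_one this, C', hC'.comp hφ⟩
  obtain ⟨b, E, hδE, hb⟩ : ∃ (b : ℕ →₀ ℝ) (E : Finset ℕ),
      δ * ∑ i ∈ E, |b i| ≤ ‖∑ i ∈ E, b i • (x ∘ φ) i‖ ∧
      Λ * ‖b.sum fun i c => c • (x ∘ φ) i‖ < ‖∑ i ∈ E, b i • (x ∘ φ) i‖ := by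
    by_contra! hcon
    exact h1 (iInf₂_le Λ ⟨hbasic, hcon⟩)
  obtain ⟨r, a, F, hr, -, ha, hF, hnorm, hFn, hFs, -, hlt⟩ :=
    exists_normalized_of_comp hC hφ Λ.2 hb
  refine ⟨a, F, fun i hi => ?_, hF, hnorm, ?_, hlt⟩
  · obtain ⟨k, rfl⟩ := ha i hi
    exact hφL k
  · rw [hFn, hFs]
    nlinarith

/-! ### The two inequalities and equality of the suprema -/

theorem exists_pos_mul_one_add_sq_lt {a a' b b' : ℝ} (ha : a < a') (hb : b < b') :
    ∃ η : ℝ, 0 < η ∧ a * (1 + η) ^ 2 < a' ∧ b * (1 + η) ^ 2 < b' := by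
  have h : ∀ c : ℝ, Tendsto (fun η : ℝ => c * (1 + η) ^ 2) (𝓝[>] 0) (𝓝 c) := fun c => by
    have : Continuous fun η : ℝ => c * (1 + η) ^ 2 := by fun_prop
    simpa using (this.tendsto 0).mono_left nhdsWithin_le_nhds
  obtain ⟨η, hη, h1, h2⟩ := (eventually_mem_nhdsWithin.and
    (((h a).eventually_lt_const ha).and ((h b).eventually_lt_const hb))).exists
  exact ⟨η, hη, h1, h2⟩

theorem convexConst_le_mul_nearConst {δ₁ δ : ℝ} (h₁ : 0 < δ₁) (h₁δ : δ₁ < δ) :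
    convexConst.{u} δ ≤ ENNReal.ofReal (δ / (δ - δ₁)) * nearConst.{u} δ₁ := by
  have hδ : 0 < δ := h₁.trans h₁δ
  have hd : 0 < δ / (δ - δ₁) := div_pos hδ (sub_pos.2 h₁δ)
  by_contra! hlt
  conv_rhs at hlt => rw [convexConst]
  simp only [lt_iSup_iff] at hlt
  obtain ⟨X, _, _, _, x, hx, hlt⟩ := hlt
  obtain ⟨Λ, hΛ, hΛx⟩ := ENNReal.lt_iff_exists_nnreal_btwn.1 hlt
  rw [mul_comm, ← ENNReal.lt_div_iff_mul_lt (Or.inl (ENNReal.ofReal_pos.2 hd).ne')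
    (Or.inl ENNReal.ofReal_ne_top)] at hΛ
  obtain ⟨μ, hμ, hμΛ⟩ := ENNReal.lt_iff_exists_nnreal_btwn.1 hΛ
  rw [ENNReal.lt_div_iff_mul_lt (Or.inl (ENNReal.ofReal_pos.2 hd).ne')
    (Or.inl ENNReal.ofReal_ne_top), ENNReal.ofReal, ← ENNReal.coe_mul, ENNReal.coe_lt_coe,
    ← NNReal.coe_lt_coe, NNReal.coe_mul, Real.coe_toNNReal _ hd.le, ← mul_div_assoc,
    div_lt_iff₀ (sub_pos.2 h₁δ)] at hμΛ
  have hμ0 : (0 : ℝ) ≤ μ := μ.2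
  have hΛ0 : (0 : ℝ) < Λ := by
    refine lt_of_le_of_ne Λ.2 fun h => ?_
    have h' : (Λ : ℝ) = 0 := h.symm
    rw [h', zero_mul] at hμΛ
    exact absurd hμΛ (not_lt.2 (by positivity))
  -- The threshold δ₂ is slightly above δ₁: the dual vector must be divided by (1+η)² to have norm
  -- at most 1, and its coefficients must then still be at least δ₁.
  obtain ⟨δ₂, h12, h2⟩ : ∃ δ₂, δ₁ < δ₂ ∧ μ * δ < Λ * (δ - δ₂) := by
    refine ⟨δ₁ + (Λ * (δ - δ₁) - μ * δ) / (2 * Λ), ?_, ?_⟩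
    · have : 0 < (Λ * (δ - δ₁) - μ * δ) / (2 * Λ) := div_pos (by linarith) (by linarith)
      linarith
    · have : (Λ : ℝ) * ((Λ * (δ - δ₁) - μ * δ) / (2 * Λ)) = (Λ * (δ - δ₁) - μ * δ) / 2 := by
        field_simp
      nlinarith
  set ν : ℝ := Λ * (1 - δ₂ / δ) with hν
  have hμν : (μ : ℝ) < ν := by
    rw [hν, one_sub_div hδ.ne', ← mul_div_assoc, lt_div_iff₀ hδ]
    exact h2
  have hδ2 : 0 ≤ 1 - δ₂ / δ := by
    by_contra! hneg
    nlinarith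
  obtain ⟨η, hη, hη1, hη2⟩ := exists_pos_mul_one_add_sq_lt h12 hμν
  obtain ⟨φ₀, hφ₀, hcoord, htrunc⟩ := exists_coordBound_truncBound hx hη
  have hx₀ := hx.comp hφ₀
  have hfail : ∀ φ, StrictMono φ → (Λ : ℝ≥0∞) < convexConstOf ((x ∘ φ₀) ∘ φ) δ := fun φ hφ =>
    hΛx.trans_le (iInf₂_le (φ₀ ∘ φ) (hφ₀.comp hφ))
  obtain ⟨Y, _, _, _, z, n, w, hz, hn, hw, hdual⟩ := exists_dual_sequence hx₀ hη hcoord htrunc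
    (W := fun a f => ‖f‖ ≤ 1 ∧ ‖a.sum fun i c => c • (x ∘ φ₀) i‖ ≤ 1 ∧ ∃ F ⊆ a.support,
      (∀ i ∈ F, δ₂ ≤ |f ((x ∘ φ₀) i)|) ∧ ν ≤ ∑ i ∈ F, f ((x ∘ φ₀) i) * a i)
    (fun a f h => ⟨h.1, h.2.1⟩) (by
      intro L hL
      obtain ⟨a, E, haL, hE, hnorm, hδE, hΛE⟩ :=
        exists_of_lt_convexConstOf hx₀ hcoord htrunc hfail hL
      obtain ⟨f, hf1, hf⟩ := exists_dual_vector'' ℝ (∑ i ∈ E, a i • (x ∘ φ₀) i)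
      refine ⟨a, f, haL, hf1, hnorm.le, E.filter fun i => δ₂ ≤ |f ((x ∘ φ₀) i)|,
        (Finset.filter_subset _ _).trans hE, fun i hi => (Finset.mem_filter.1 hi).2, ?_⟩
      rw [map_sum] at hf
      simp only [map_smul, smul_eq_mul, RCLike.ofReal_real_eq_id, id_eq] at hf
      rw [← Finset.sum_filter_add_sum_filter_not E (fun i => δ₂ ≤ |f ((x ∘ φ₀) i)|)] at hf
      -- The discarded indices contribute at most δ₂∑|aᵢ| ≤ (δ₂/δ)‖∑_{i∈E} aᵢxᵢ‖, leaving at least ν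
      -- = Λ(1 - δ₂/δ) > μ.
      have hsmall : ∑ i ∈ E.filter (fun i => ¬ δ₂ ≤ |f ((x ∘ φ₀) i)|), a i * f ((x ∘ φ₀) i) ≤
          δ₂ * ∑ i ∈ E, |a i| := by
        rw [Finset.mul_sum]
        refine (Finset.sum_le_sum fun i hi => ?_).trans
          (Finset.sum_le_sum_of_subset_of_nonneg (Finset.filter_subset _ _) fun i _ _ =>
            mul_nonneg (h₁.trans h12).le (abs_nonneg (a i)))
        have h3 := not_le.1 (Finset.mem_filter.1 hi).2
        refine (le_abs_self _).trans ?_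
        rw [abs_mul, mul_comm]
        exact mul_le_mul_of_nonneg_right h3.le (abs_nonneg _)
      have h4 : δ₂ * ∑ i ∈ E, |a i| ≤ δ₂ / δ * ‖∑ i ∈ E, a i • (x ∘ φ₀) i‖ := by
        rw [div_mul_eq_mul_div, le_div_iff₀ hδ]
        nlinarith [h₁.trans h12]
      have h5 : ν ≤ (1 - δ₂ / δ) * ‖∑ i ∈ E, a i • (x ∘ φ₀) i‖ := by
        rw [hν, mul_comm]
        exact mul_le_mul_of_nonneg_left hΛE.le hδ2
      simp only [mul_comm (f _)]
      linarith)
  obtain ⟨φ, hφ, hnear⟩ := exists_subsequence_of_nearConst_lt hμ hz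
  obtain ⟨a, f, s, ⟨-, -, F, hF, hFδ, hFν⟩, has, hnorm, hlow⟩ := hdual φ hφ
  obtain ⟨E, hE, rfl⟩ := Finset.subset_image_iff.1 (hF.trans has)
  have hinj : Function.Injective (n ∘ φ) := (hn.comp hφ).injective
  rw [Finset.sum_image hinj.injOn] at hFν
  have hpos : 0 < (1 + η) ^ 2 := by positivity
  have hscale : ∀ T : Finset ℕ, ∑ k ∈ T, (((1 + η) ^ 2)⁻¹ * (f ((x ∘ φ₀) (n (φ k))) * w (φ k))) •
      z (φ k) = ((1 + η) ^ 2)⁻¹ • ∑ k ∈ T, (f ((x ∘ φ₀) (n (φ k))) * w (φ k)) • z (φ k) :=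
    fun T => by
      rw [Finset.smul_sum]
      exact Finset.sum_congr rfl fun k _ => mul_smul _ _ _
  have hfin := hnear (fun k => ((1 + η) ^ 2)⁻¹ * (f ((x ∘ φ₀) (n (φ k))) * w (φ k))) s E
    (Finset.coe_subset.1 hE) (fun k hk => by
      have h6 := hFδ _ (Finset.mem_image_of_mem _ hk)
      have h7 := hw (φ k)
      rw [abs_mul, abs_mul, abs_of_pos (inv_pos.2 hpos), le_inv_mul_iff₀ hpos,
        abs_of_pos (one_pos.trans_le h7.1)]
      have h8 : δ₂ * 1 ≤ |f ((x ∘ φ₀) (n (φ k)))| * w (φ k) :=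
        mul_le_mul h6 h7.1 zero_le_one (abs_nonneg _)
      linarith) (by
      rw [hscale, norm_smul, norm_inv, Real.norm_of_nonneg hpos.le, inv_mul_le_iff₀ hpos, mul_one]
      exact hnorm)
  rw [hscale, hscale, norm_smul, norm_smul, norm_inv, Real.norm_of_nonneg hpos.le,
    mul_left_comm] at hfin
  have h9 := le_of_mul_le_mul_left hfin (inv_pos.2 hpos)
  have h10 := hFν.trans (hlow E (Finset.coe_subset.1 hE))
  have h11 := mul_le_mul_of_nonneg_left hnorm hμ0
  linarith

theorem nearConst_le_convexConst {δ₁ δ : ℝ} (h₁ : 0 < δ₁) (h₁δ : δ₁ < δ) :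
    nearConst.{u} δ ≤ convexConst.{u} δ₁ := by
  have hδ : 0 < δ := h₁.trans h₁δ
  by_contra! hlt
  conv_rhs at hlt => rw [nearConst]
  simp only [lt_iSup_iff] at hlt
  obtain ⟨X, _, _, _, x, hx, hlt⟩ := hlt
  obtain ⟨Λ, hΛ, hΛx⟩ := ENNReal.lt_iff_exists_nnreal_btwn.1 hlt
  obtain ⟨μ, hμ, hμΛ⟩ := ENNReal.lt_iff_exists_nnreal_btwn.1 hΛ
  have hμΛ' : (μ : ℝ) < Λ := by exact_mod_cast hμΛ
  obtain ⟨η, hη, hη1, hη2⟩ := exists_pos_mul_one_add_sq_lt h₁δ hμΛ'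
  obtain ⟨φ₀, hφ₀, hcoord, htrunc⟩ := exists_coordBound_truncBound hx hη
  have hx₀ := hx.comp hφ₀
  have hfail : ∀ φ, StrictMono φ → (Λ : ℝ≥0∞) < nearConstOf ((x ∘ φ₀) ∘ φ) δ := fun φ hφ =>
    hΛx.trans_le (iInf₂_le (φ₀ ∘ φ) (hφ₀.comp hφ))
  obtain ⟨Y, _, _, _, z, n, w, hz, hn, hw, hdual⟩ := exists_dual_sequence hx₀ hη hcoord htrunc
    (W := fun a f => ‖f‖ ≤ 1 ∧ ‖a.sum fun i c => c • (x ∘ φ₀) i‖ ≤ 1 ∧ ∃ F ⊆ a.support,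
      (∀ i ∈ F, δ ≤ |a i| ∧ 0 ≤ f ((x ∘ φ₀) i) * a i) ∧ Λ ≤ ∑ i ∈ F, f ((x ∘ φ₀) i) * a i)
    (fun a f h => ⟨h.1, h.2.1⟩) (by
      intro L hL
      obtain ⟨a, E, haL, hE, hnorm, hδE, hΛE⟩ := exists_of_lt_nearConstOf hcoord hδ hfail hL
      obtain ⟨f, hf1, hf⟩ := exists_dual_vector'' ℝ (∑ i ∈ E, a i • (x ∘ φ₀) i)
      refine ⟨a, f, haL, hf1, hnorm.le, E.filter fun i => 0 ≤ f ((x ∘ φ₀) i) * a i,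
        (Finset.filter_subset _ _).trans hE,
        fun i hi => ⟨hδE i (Finset.mem_filter.1 hi).1, (Finset.mem_filter.1 hi).2⟩, ?_⟩
      rw [map_sum] at hf
      simp only [map_smul, smul_eq_mul, RCLike.ofReal_real_eq_id, id_eq, mul_comm (a _)] at hf
      rw [← Finset.sum_filter_add_sum_filter_not E (fun i => 0 ≤ f ((x ∘ φ₀) i) * a i)] at hf
      have hneg : ∑ i ∈ E.filter (fun i => ¬ 0 ≤ f ((x ∘ φ₀) i) * a i), f ((x ∘ φ₀) i) * a i ≤ 0 :=
        Finset.sum_nonpos fun i hi => (not_le.1 (Finset.mem_filter.1 hi).2).le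
      linarith)
  obtain ⟨φ, hφ, hconv⟩ := exists_subsequence_of_convexConst_lt hμ hz
  obtain ⟨a, f, s, ⟨-, -, F, hF, hFδ, hFΛ⟩, has, hnorm, hlow⟩ := hdual φ hφ
  obtain ⟨E, hE, rfl⟩ := Finset.subset_image_iff.1 (hF.trans has)
  have hinj : Function.Injective (n ∘ φ) := (hn.comp hφ).injective
  rw [Finset.sum_image hinj.injOn] at hFΛ
  have hlowE := hlow E (Finset.coe_subset.1 hE)
  have hfin := hconv (fun k => f ((x ∘ φ₀) (n (φ k))) * w (φ k)) s E (Finset.coe_subset.1 hE) (by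
    refine le_trans ?_ hlowE
    rw [Finset.mul_sum]
    refine Finset.sum_le_sum fun k hk => ?_
    obtain ⟨h3, h4⟩ := hFδ _ (Finset.mem_image_of_mem _ hk)
    have h5 := hw (φ k)
    -- The gap between δ₁ and δ absorbs the normalizing weights. No rescaling of the dual vector is
    -- needed, as the convexity condition is homogeneous.
    have h6 : δ₁ * w (φ k) ≤ δ := by nlinarith [mul_le_mul_of_nonneg_left h5.2 h₁.le]
    have h7 : f ((x ∘ φ₀) (n (φ k))) * a (n (φ k)) =
        |f ((x ∘ φ₀) (n (φ k)))| * |a (n (φ k))| := by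
      rw [← abs_mul]; exact (abs_of_nonneg h4).symm
    rw [h7, abs_mul, abs_of_pos (one_pos.trans_le h5.1), mul_left_comm]
    exact mul_le_mul_of_nonneg_left (h6.trans h3) (abs_nonneg _))
  have h11 := mul_le_mul_of_nonneg_left hnorm μ.2
  have h10 := (hFΛ.trans hlowE).trans (hfin.trans h11)
  exact absurd h10 (not_le.2 hη2)

end PartialUncond

theorem theorem6p2 :
    (∀ δ₁ δ : ℝ, 0 < δ₁ → δ₁ < δ → δ ≤ 1 →
      PartialUncond.convexConst.{u} δ
          ≤ ENNReal.ofReal (δ / (δ - δ₁)) * PartialUncond.nearConst.{u} δ₁ ∧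
        PartialUncond.nearConst.{u} δ ≤ PartialUncond.convexConst.{u} δ₁) ∧
      (⨆ δ ∈ Set.Ioc (0 : ℝ) 1, PartialUncond.convexConst.{u} δ)
        = ⨆ δ ∈ Set.Ioc (0 : ℝ) 1, PartialUncond.nearConst.{u} δ := by
  refine ⟨fun δ₁ δ h₁ h₁δ _ => ⟨PartialUncond.convexConst_le_mul_nearConst h₁ h₁δ,
    PartialUncond.nearConst_le_convexConst h₁ h₁δ⟩, le_antisymm ?_ ?_⟩
  · refine iSup₂_le fun δ hδ => ?_
    have hlim : Tendsto (fun δ₁ : ℝ => ENNReal.ofReal (δ / (δ - δ₁)) *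
        ⨆ δ ∈ Set.Ioc (0 : ℝ) 1, PartialUncond.nearConst.{u} δ) (𝓝[>] 0)
        (𝓝 (1 * ⨆ δ ∈ Set.Ioc (0 : ℝ) 1, PartialUncond.nearConst.{u} δ)) := by
      -- As δ₁ → 0 the factor tends to 1; this limit is nonzero, so the supremum may be infinite.
      refine ENNReal.Tendsto.mul_const ?_ (Or.inl one_ne_zero)
      have hc : ContinuousAt (fun δ₁ : ℝ => δ / (δ - δ₁)) 0 :=
        continuousAt_const.div (continuousAt_const.sub continuousAt_id) (by simpa using hδ.1.ne')
      have := (ENNReal.continuous_ofReal.tendsto _).comp (hc.tendsto.mono_left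
        (nhdsWithin_le_nhds (s := Set.Ioi 0)))
      simpa [Function.comp_def, div_self hδ.1.ne'] using this
    rw [one_mul] at hlim
    refine ge_of_tendsto hlim ?_
    filter_upwards [Ioo_mem_nhdsGT hδ.1] with δ₁ hδ₁
    refine (PartialUncond.convexConst_le_mul_nearConst hδ₁.1 hδ₁.2).trans ?_
    gcongr
    exact le_iSup₂_of_le δ₁ ⟨hδ₁.1, hδ₁.2.le.trans hδ.2⟩ le_rfl
  · refine iSup₂_le fun δ hδ => ?_
    refine (PartialUncond.nearConst_le_convexConst (half_pos hδ.1) (half_lt_self hδ.1)).trans ?_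
    exact le_iSup₂_of_le (δ / 2) ⟨half_pos hδ.1, (half_le_self hδ.1.le).trans hδ.2⟩ le_rfl
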